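/- Let $(\Omega,\mathcal F,P)$ be a probability space, $K\in\{\mathbb R,\mathbb C\}$, and let $L^0(\mathcal F,K)$ be the algebra of ($P$-a.s. equality) classes of $K$-valued $\mathcal F$-measurable random variables, $L^0(\mathcal F)=L^0(\mathcal F,\mathbb R)$ with the a.s. order, $L^0_{+}(\mathcal F)=\{\xi\in L^0(\mathcal F):\xi\ge 0\}$ and $L^0_{++}(\mathcal F)=\{\xi\in L^0(\mathcal F):\xi>0\text{ a.s.}\}$. A *random normed (RN) module* over $K$ with base $(\Omega,\mathcal F,P)$ is an $L^0(\mathcal F,K)$-module $E$ with an $L^0$-norm $\|\cdot\|:E\to L^0_+(\mathcal F)$, i.e. $\|x\|=0\Rightarrow x=0$, $\|x+y\|\le\|x\|+\|y\|$, and $\|\xi x\|=|\xi|\,\|x\|$ for all $x,y\in E$, $\xi\in L^0(\mathcal F,K)$. Its *locally $L^0$-convex topology* $\mathcal T_c$ is the topology in which $G\subseteq E$ is open iff for every $x\in G$ there is $\varepsilon\in L^0_{++}(\mathcal F)$ with $\{y:\|y-x\|\le\varepsilon\}\subseteq G$. $(E,\|\cdot\|)$ is $\mathcal T_c$-complete if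 every $\mathcal T_c$-Cauchy net converges. A set $G\subseteq E$ has the *countable concatenation property* if for every partition $(A_n)_{n\in\mathbb N}$ of $\Omega$ into (possibly empty) members of $\mathcal F$ and every sequence $(x_n)$ in $G$ there is $x\in G$ with $1_{A_n}x=1_{A_n}x_n$ for all $n$. A set $B\subseteq E$ is *$L^0$-balanced* if $\eta B\subseteq B$ whenever $\eta\in L^0(\mathcal F,K)$, $|\eta|\le 1$; *$L^0$-absorbent* if for every $x\in E$ there is $\xi\in L^0_{++}(\mathcal F)$ such that $\eta x\in B$ for all $\eta\in L^0(\mathcal F,K)$ with $|\eta|\le\xi$; *$L^0$-convex* if $\xi x+(1-\xi)y\in B$ for $x,y\in B$, $\xi\in L^0(\mathcal F)$, $0\le\xi\le1$. For a topology $\mathcal T$ on $E$, $(E,\mathcal T)$ is a *locally $L^0$-convex module* if addition and module multiplication are jointly continuous, where $L^0(\mathcal F,K)$ carries the topology $\mathcal T_c$ of $|\cdot|$, and $0$ has a local base of $L^0$-balanced, $L^0$-absorbent, $L^0$-convex sets. An *$L^0$-barrel* is a closed, $L^0$-balanced, $L^0$-absorbent, $L^0$-convex set. A locally $L^0$-convex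 module $(E,\mathcal T)$ is *$L^0$-pre-barreled* if every $L^0$-barrel with the countable concatenation property is a neighbourhood of $0$. **Statement.** (1) Let $(E,\|\cdot\|)$ be a $\mathcal T_c$-complete RN module over $K$ with base $(\Omega,\mathcal F,P)$ such that $E$ has the countable concatenation property. Then $(E,\mathcal T_c)$ is $L^0$-pre-barreled. (2) Let $(\Omega,\mathcal E,P)$ be a probability space, $\mathcal F$ a $\sigma$-subalgebra of $\mathcal E$, and $p\in[1,\infty]$. For $x\in L^0(\mathcal E)$ put $|||x|||_p=E[|x|^p\mid\mathcal F]^{1/p}$ if $p<\infty$, where the conditional expectation of a non-negative random variable may take the value $+\infty$, and let $|||x|||_\infty$ be the infimum of all classes $\xi$ of $[0,\infty]$-valued $\mathcal F$-measurable random variables with $|x|\le\xi$. Let $L^p_{\mathcal F}(\mathcal E)=\{x\in L^0(\mathcal E):|||x|||_p<\infty\text{ a.s.}\}$, an $L^0(\mathcal F)$-module under multiplication. Then $(L^p_{\mathcal F}(\mathcal E),|||\cdot|||_p)$ is an RN module over $\mathbb R$ with base $(\Omega,\mathcal F,P)$, and $(L^p_{\mathcal F}(\mathcal E),\mathcal T_c)$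 is $L^0$-pre-barreled. -/

import Mathlib

open MeasureTheory

namespace RandomModule

/-! ### The algebra `L⁰(F, K)` -/

section L0

variable {Ω : Type*} {m : MeasurableSpace Ω}

/-- `L⁰(F, K)`: almost everywhere equality classes of `K`-valued random variables. -/
abbrev L0 (μ : Measure Ω) (K : Type*) [TopologicalSpace K] : Type _ := Ω →ₘ[μ] K

/-- Mathlib supplies the additive group and the multiplicative monoid of classes of functions;
this combines them to a commutative ring. -/
instance instCommRingL0 {μ : Measure Ω} {R : Type*} [CommRing R] [TopologicalSpace R]
    [IsTopologicalRing R] : CommRing (Ω →ₘ[μ] R) :=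
  { (inferInstance : AddCommGroup (Ω →ₘ[μ] R)), (inferInstance : CommMonoid (Ω →ₘ[μ] R)) with
    left_distrib := fun a b c => by
      apply AEEqFun.ext
      filter_upwards [AEEqFun.coeFn_mul a (b + c), AEEqFun.coeFn_add b c,
        AEEqFun.coeFn_add (a * b) (a * c), AEEqFun.coeFn_mul a b, AEEqFun.coeFn_mul a c]
        with ω h1 h2 h3 h4 h5
      simp only [Pi.mul_apply, Pi.add_apply] at h1 h2 h3 h4 h5
      rw [h1, h2, h3, h4, h5, mul_add]
    right_distrib := fun a b c => by
      apply AEEqFun.ext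
      filter_upwards [AEEqFun.coeFn_mul (a + b) c, AEEqFun.coeFn_add a b,
        AEEqFun.coeFn_add (a * c) (b * c), AEEqFun.coeFn_mul a c, AEEqFun.coeFn_mul b c]
        with ω h1 h2 h3 h4 h5
      simp only [Pi.mul_apply, Pi.add_apply] at h1 h2 h3 h4 h5
      rw [h1, h2, h3, h4, h5, add_mul]
    zero_mul := fun a => by
      apply AEEqFun.ext
      filter_upwards [AEEqFun.coeFn_mul 0 a, AEEqFun.coeFn_zero (α := Ω) (μ := μ) (β := R)]
        with ω h1 h2
      simp only [Pi.mul_apply, Pi.zero_apply] at h1 h2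
      rw [h1, h2, zero_mul]
    mul_zero := fun a => by
      apply AEEqFun.ext
      filter_upwards [AEEqFun.coeFn_mul a 0, AEEqFun.coeFn_zero (α := Ω) (μ := μ) (β := R)]
        with ω h1 h2
      simp only [Pi.mul_apply, Pi.zero_apply] at h1 h2
      rw [h1, h2, mul_zero] }

variable {μ : Measure Ω} {K : Type*} [RCLike K]

/-- The modulus `|ξ|` of `ξ ∈ L⁰(F, K)`. -/
noncomputable def L0abs (ξ : L0 μ K) : L0 μ ℝ := ξ.comp (fun z => ‖z‖) continuous_norm

/-- The inclusion of `L⁰(F) = L⁰(F, ℝ)` in `L⁰(F, K)`. -/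
noncomputable def L0ofReal (K : Type*) [RCLike K] (ξ : L0 μ ℝ) : L0 μ K :=
  ξ.comp (RCLike.ofReal : ℝ → K) RCLike.continuous_ofReal

/-- `L⁰₊₊(F)`: the classes that are strictly positive almost surely. -/
def L0pp (μ : Measure Ω) : Set (L0 μ ℝ) := {ε | ∀ᵐ ω ∂μ, 0 < ε ω}

/-- The class of the indicator function of the event `A`. -/
noncomputable def L0ind (μ : Measure Ω) (K : Type*) [RCLike K] (A : Set Ω)
    (hA : MeasurableSet A) : L0 μ K :=
  AEEqFun.mk (A.indicator fun _ => (1 : K)) (aestronglyMeasurable_const.indicator hA)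

end L0

/-! ### Random normed modules and locally `L⁰`-convex modules -/

section Modules

variable {Ω : Type*} {m : MeasurableSpace Ω} {μ : Measure Ω}
  {E : Type*} [AddCommGroup E]

/-- `N` is an `L⁰`-norm on the `L⁰(F, K)`-module `E`, that is, `(E, N)` is a random normed
module over `K`. -/
structure IsL0Norm (K : Type*) [RCLike K] [Module (L0 μ K) E] (N : E → L0 μ ℝ) : Prop where
  nonneg : ∀ x, 0 ≤ N x
  eq_zero : ∀ x, N x = 0 → x = 0
  add_le : ∀ x y, N (x + y) ≤ N x + N y
  smul : ∀ (ξ : L0 μ K) (x : E), N (ξ • x) = L0abs ξ * N x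

/-- The topology `T_c` of `N : E → L⁰₊(F)`: a set is open iff with each of its points `x` it
contains some `{y | N (y - x) ≤ ε}` with `ε ∈ L⁰₊₊(F)`. -/
@[reducible] def Tc (N : E → L0 μ ℝ) : TopologicalSpace E where
  IsOpen G := ∀ x ∈ G, ∃ ε ∈ L0pp μ, ∀ y, N (y - x) ≤ ε → y ∈ G
  isOpen_univ := fun _ _ =>
    ⟨1, show ∀ᵐ ω ∂μ, 0 < (1 : L0 μ ℝ) ω by
      filter_upwards [AEEqFun.coeFn_one (α := Ω) (μ := μ) (β := ℝ)] with ω h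
      rw [h]; exact one_pos, fun _ _ => trivial⟩
  isOpen_inter := fun s t hs ht x hx => by
    obtain ⟨ε, hε, h1⟩ := hs x hx.1
    obtain ⟨δ, hδ, h2⟩ := ht x hx.2
    refine ⟨ε ⊓ δ, show ∀ᵐ ω ∂μ, 0 < (ε ⊓ δ) ω from ?_, fun y hy => ⟨h1 y (hy.trans inf_le_left), h2 y (hy.trans inf_le_right)⟩⟩
    filter_upwards [AEEqFun.coeFn_inf ε δ, hε, hδ] with ω h h3 h4
    rw [h]; exact lt_min h3 h4
  isOpen_sUnion := fun S hS x ⟨t, ht, hx⟩ => by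
    obtain ⟨ε, hε, h⟩ := hS t ht x hx
    exact ⟨ε, hε, fun y hy => ⟨t, ht, h y hy⟩⟩

/-- Completeness of an additive topological group: every Cauchy filter converges (which is
equivalent to the convergence of every Cauchy net). -/
def IsTopComplete (T : TopologicalSpace E) : Prop :=
  ∀ F : Filter E, F.NeBot →
    (∀ U ∈ @nhds E T 0, ∃ S ∈ F, ∀ x ∈ S, ∀ y ∈ S, y - x ∈ U) → ∃ x, F ≤ @nhds E T x

variable (μ) (K : Type*) [RCLike K] [Module (L0 μ K) E]

/-- The countable concatenation property of a subset `G` of `E`: for every countable partition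
`(A n)` of `Ω` into events and every sequence `(x n)` in `G`, some `y ∈ G` agrees with `x n`
on `A n` for all `n`. -/
def HasCountableConcat (G : Set E) : Prop :=
  ∀ (A : ℕ → Set Ω) (hA : ∀ n, MeasurableSet (A n)), Pairwise (Function.onFun Disjoint A) →
    (⋃ n, A n) = Set.univ → ∀ x : ℕ → E, (∀ n, x n ∈ G) →
      ∃ y ∈ G, ∀ n, L0ind μ K (A n) (hA n) • y = L0ind μ K (A n) (hA n) • x n

/-- `A` is `L⁰`-absorbed by `B`. -/
def IsL0AbsorbedBy (A B : Set E) : Prop :=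
  ∃ ξ ∈ L0pp μ, ∀ η : L0 μ K, L0abs η ≤ ξ → ∀ a ∈ A, η • a ∈ B

/-- `L⁰`-absorbent sets. -/
def IsL0Absorbent (B : Set E) : Prop := ∀ x : E, IsL0AbsorbedBy μ K {x} B

/-- `L⁰`-convex sets. -/
def IsL0Convex (B : Set E) : Prop :=
  ∀ x ∈ B, ∀ y ∈ B, ∀ ξ : L0 μ ℝ, 0 ≤ ξ → ξ ≤ 1 →
    L0ofReal K ξ • x + (1 - L0ofReal K ξ) • y ∈ B

/-- `L⁰`-balanced sets. -/
def IsL0Balanced (B : Set E) : Prop :=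
  ∀ η : L0 μ K, L0abs η ≤ 1 → ∀ x ∈ B, η • x ∈ B

/-- `(E, T)` is a locally `L⁰`-convex `L⁰(F, K)`-module: addition and module multiplication are
jointly continuous, where `L⁰(F, K)` carries the topology `T_c` of `|·|`, and `0` has a local
base of `L⁰`-balanced, `L⁰`-absorbent and `L⁰`-convex sets. -/
structure IsLocallyL0ConvexModule (T : TopologicalSpace E) : Prop where
  continuousAdd : @ContinuousAdd E T _
  continuousSMul : @ContinuousSMul (L0 μ K) E _ (Tc (L0abs (μ := μ) (K := K))) T
  localBase : ∀ U ∈ @nhds E T 0, ∃ V ∈ @nhds E T 0, V ⊆ U ∧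
    IsL0Balanced μ K V ∧ IsL0Absorbent μ K V ∧ IsL0Convex μ K V

/-- `L⁰`-barrels of `(E, T)`. -/
structure IsL0Barrel (T : TopologicalSpace E) (B : Set E) : Prop where
  balanced : IsL0Balanced μ K B
  absorbent : IsL0Absorbent μ K B
  convex : IsL0Convex μ K B
  closed : @IsClosed E T B

/-- `(E, T)` is an `L⁰`-pre-barreled module: it is a locally `L⁰`-convex module in which every
`L⁰`-barrel with the countable concatenation property is a neighbourhood of `0`. -/
structure IsL0PreBarreled (T : TopologicalSpace E) : Prop where
  locallyConvex : IsLocallyL0ConvexModule μ K T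
  barrel_mem_nhds : ∀ B : Set E, IsL0Barrel μ K T B → HasCountableConcat μ K B →
    B ∈ @nhds E T 0

end Modules

/-! ### The modules `L^p_F(E)` -/

section Aux

open scoped ENNReal

variable {Ω Ω' : Type*} {m : MeasurableSpace Ω} {m' : MeasurableSpace Ω'} {μ : Measure Ω}
  {ν : Measure Ω'}

/-- Composition with a measure preserving map, as a ring homomorphism. -/
noncomputable def L0comp (f : Ω → Ω') (hf : MeasurePreserving f μ ν) :
    L0 ν ℝ →+* L0 μ ℝ where
  toFun ξ := ξ.compMeasurePreserving f hf
  map_one' := rfl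
  map_zero' := rfl
  map_mul' ξ η := by
    induction ξ using AEEqFun.induction_on
    induction η using AEEqFun.induction_on
    rfl
  map_add' ξ η := by
    induction ξ using AEEqFun.induction_on
    induction η using AEEqFun.induction_on
    rfl

theorem coe_L0comp (f : Ω → Ω') (hf : MeasurePreserving f μ ν) (ξ : L0 ν ℝ) :
    L0comp f hf ξ =ᵐ[μ] fun ω => ξ (f ω) :=
  AEEqFun.coeFn_compMeasurePreserving ξ hf

/-- A (strongly measurable) representative of a class. -/
noncomputable abbrev L0rep {β : Type*} [TopologicalSpace β] (ξ : Ω →ₘ[μ] β) : Ω → β := ξ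

/-- The class of a measurable `[0, ∞]`-valued function. -/
noncomputable def L0mkENN (μ : Measure Ω) (f : Ω → ℝ≥0∞) (hf : Measurable f) : Ω →ₘ[μ] ℝ≥0∞ :=
  AEEqFun.mk f hf.aestronglyMeasurable

theorem L0rep_L0mkENN (f : Ω → ℝ≥0∞) (hf : Measurable f) :
    L0rep (L0mkENN μ f hf) =ᵐ[μ] f := AEEqFun.coeFn_mk _ _

theorem measurable_L0rep (ξ : Ω →ₘ[μ] ℝ≥0∞) : Measurable (L0rep ξ) :=
  AEEqFun.measurable ξ

/-- The class of the constant `∞`. -/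
noncomputable def L0top (μ : Measure Ω) : Ω →ₘ[μ] ℝ≥0∞ := L0mkENN μ (fun _ => ∞) measurable_const

theorem L0rep_L0top : L0rep (L0top μ) =ᵐ[μ] fun _ => ∞ := L0rep_L0mkENN _ _

theorem L0rep_L0mkENN_iInf (u : ℕ → (Ω →ₘ[μ] ℝ≥0∞)) :
    L0rep (L0mkENN μ (fun ω => ⨅ n, L0rep (u n) ω)
      (Measurable.iInf fun n => measurable_L0rep (u n))) =ᵐ[μ] fun ω => ⨅ n, L0rep (u n) ω :=
  L0rep_L0mkENN _ _

/-- The class `f ^ r` for a measurable function `f`. -/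
noncomputable def L0rpow (μ : Measure Ω) (f : Ω → ℝ≥0∞) (hf : Measurable f) (r : ℝ) :
    Ω →ₘ[μ] ℝ≥0∞ := L0mkENN μ (fun ω => f ω ^ r) (hf.pow_const r)

theorem L0rep_L0rpow (f : Ω → ℝ≥0∞) (hf : Measurable f) (r : ℝ) :
    L0rep (L0rpow μ f hf r) =ᵐ[μ] fun ω => f ω ^ r := L0rep_L0mkENN _ _

/-- The class of the constant `0`. -/
noncomputable def L0zero (μ : Measure Ω) : Ω →ₘ[μ] ℝ≥0∞ := L0mkENN μ (fun _ => 0) measurable_const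

theorem L0rep_L0zero : L0rep (L0zero μ) =ᵐ[μ] fun _ => 0 := L0rep_L0mkENN _ _

/-- Sum of `[0, ∞]`-valued classes. -/
noncomputable def L0addENN (ξ η : Ω →ₘ[μ] ℝ≥0∞) : Ω →ₘ[μ] ℝ≥0∞ :=
  L0mkENN μ (fun ω => L0rep ξ ω + L0rep η ω) ((measurable_L0rep ξ).add (measurable_L0rep η))

theorem L0rep_L0addENN (ξ η : Ω →ₘ[μ] ℝ≥0∞) :
    L0rep (L0addENN ξ η) =ᵐ[μ] fun ω => L0rep ξ ω + L0rep η ω := L0rep_L0mkENN _ _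

/-- Product of `[0, ∞]`-valued classes. -/
noncomputable def L0mulENN (ξ η : Ω →ₘ[μ] ℝ≥0∞) : Ω →ₘ[μ] ℝ≥0∞ :=
  L0mkENN μ (fun ω => L0rep ξ ω * L0rep η ω) ((measurable_L0rep ξ).mul (measurable_L0rep η))

theorem L0rep_L0mulENN (ξ η : Ω →ₘ[μ] ℝ≥0∞) :
    L0rep (L0mulENN ξ η) =ᵐ[μ] fun ω => L0rep ξ ω * L0rep η ω := L0rep_L0mkENN _ _

/-- The modulus of a real class as a `[0, ∞]`-valued class. -/
noncomputable def L0enorm (ξ : L0 μ ℝ) : Ω →ₘ[μ] ℝ≥0∞ :=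
  L0mkENN μ (fun ω => ‖ξ ω‖ₑ) (AEEqFun.measurable ξ).enorm

theorem L0rep_L0enorm (ξ : L0 μ ℝ) : L0rep (L0enorm ξ) =ᵐ[μ] fun ω => ‖L0rep ξ ω‖ₑ :=
  L0rep_L0mkENN _ _

theorem L0enorm_lt_top (ξ : L0 μ ℝ) : ∀ᵐ ω ∂μ, L0rep (L0enorm ξ) ω < ∞ := by
  filter_upwards [L0rep_L0enorm ξ] with ω h
  rw [h]; exact enorm_lt_top

theorem L0rep_le {ξ η : Ω →ₘ[μ] ℝ≥0∞} (h : ξ ≤ η) : L0rep ξ ≤ᵐ[μ] L0rep η :=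
  AEEqFun.coeFn_le.2 h

theorem measurable_mul_ENN {f g : Ω → ℝ≥0∞} (hf : Measurable f) (hg : Measurable g) :
    Measurable fun ω => f ω * g ω := hf.mul hg

theorem measurable_rpow_ENN {f : Ω → ℝ≥0∞} (hf : Measurable f) (r : ℝ) :
    Measurable fun ω => f ω ^ r := hf.pow_const r

theorem measurableSet_lt_top_ENN {f : Ω → ℝ≥0∞} (hf : Measurable f) :
    MeasurableSet {ω | f ω < ∞} := measurableSet_lt hf measurable_const

/-- The real-valued class given by an (almost surely finite) `[0, ∞]`-valued class. -/
noncomputable def L0toReal (ξ : Ω →ₘ[μ] ℝ≥0∞) : L0 μ ℝ :=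
  ξ.compMeasurable ENNReal.toReal ENNReal.measurable_toReal

/-- A nonempty set of classes that is closed under countable infima has an infimum, and it
belongs to the set. -/
theorem exists_isLeast_of_iInf_mem [IsFiniteMeasure μ] (S : Set (Ω →ₘ[μ] ℝ≥0∞))
    (hne : S.Nonempty)
    (hS : ∀ u : ℕ → (Ω →ₘ[μ] ℝ≥0∞), (∀ n, u n ∈ S) →
      L0mkENN μ (fun ω => ⨅ n, L0rep (u n) ω)
        (Measurable.iInf fun n => measurable_L0rep (u n)) ∈ S) :
    ∃ ξ, IsLeast S ξ := by
  let I : (Ω →ₘ[μ] ℝ≥0∞) → ℝ≥0∞ := fun ξ => ∫⁻ ω, (1 + L0rep ξ ω)⁻¹ ∂μ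
  have hmeas : ∀ ξ : Ω →ₘ[μ] ℝ≥0∞, Measurable fun ω => (1 + L0rep ξ ω)⁻¹ := fun ξ =>
    (measurable_const.add (measurable_L0rep ξ)).inv
  have hanti : ∀ ξ η : Ω →ₘ[μ] ℝ≥0∞, L0rep ξ ≤ᵐ[μ] L0rep η →
      (fun ω => (1 + L0rep η ω)⁻¹) ≤ᵐ[μ] fun ω => (1 + L0rep ξ ω)⁻¹ := fun ξ η h => by
    filter_upwards [h] with ω h
    exact ENNReal.inv_le_inv.2 (by gcongr)
  have hfin : ∀ ξ, I ξ ≠ ∞ := fun ξ => by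
    refine ne_top_of_le_ne_top (b := ∫⁻ _, 1 ∂μ) (by simp) (lintegral_mono fun ω => ?_)
    exact ENNReal.inv_le_one.2 le_self_add
  obtain ⟨v, -, hv, hvS⟩ := exists_seq_tendsto_sSup (hne.image I) (OrderTop.bddAbove _)
  choose u huS hu using hvS
  have hz := hS u huS
  set ζ := L0mkENN μ (fun ω => ⨅ n, L0rep (u n) ω)
    (Measurable.iInf fun n => measurable_L0rep (u n)) with hζ
  have hζM : sSup (I '' S) ≤ I ζ := by
    refine le_of_tendsto hv (Filter.Eventually.of_forall fun n => ?_)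
    rw [← hu n]
    refine lintegral_mono_ae (hanti _ _ ?_)
    filter_upwards [L0rep_L0mkENN (μ := μ) (fun ω => ⨅ n, L0rep (u n) ω)
      (Measurable.iInf fun n => measurable_L0rep (u n))] with ω h
    rw [hζ, h]
    exact iInf_le _ n
  refine ⟨ζ, hz, fun ξ hξ => ?_⟩
  have hw := hS (fun n => if n = 0 then ξ else ζ) (fun n => by split_ifs <;> assumption)
  set η := L0mkENN μ (fun ω => ⨅ n, L0rep (if n = 0 then ξ else ζ) ω)
    (Measurable.iInf fun n => measurable_L0rep (if n = 0 then ξ else ζ)) with hη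
  have h1 := L0rep_L0mkENN (μ := μ) (fun ω => ⨅ n : ℕ, L0rep (if n = 0 then ξ else ζ) ω)
      (Measurable.iInf fun n => measurable_L0rep (if n = 0 then ξ else ζ))
  rw [← hη] at h1
  have hηξ : L0rep η ≤ᵐ[μ] L0rep ξ := by
    filter_upwards [h1] with ω h
    rw [h]; exact (iInf_le _ 0).trans (by simp)
  have hηζ : L0rep η ≤ᵐ[μ] L0rep ζ := by
    filter_upwards [h1] with ω h
    rw [h]; exact (iInf_le _ 1).trans (by simp)
  have heq := ae_eq_of_ae_le_of_lintegral_le (hanti _ _ hηζ) (hfin ζ) (hmeas η).aemeasurable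
    ((le_sSup ⟨η, hw, rfl⟩ : I η ≤ sSup (I '' S)).trans hζM)
  rw [← AEEqFun.coeFn_le]
  filter_upwards [heq, hηξ] with ω h2 h3
  have h4 : L0rep ζ ω = L0rep η ω := by
    have := inv_injective h2
    exact (ENNReal.add_right_inj ENNReal.one_ne_top).1 this
  exact h4.le.trans h3

end Aux

section LpF

open scoped ENNReal

variable {Ω : Type*} {m m0 : MeasurableSpace Ω} {μ : Measure[m0] Ω}

theorem measurePreserving_id_trim (hm : m ≤ m0) :
    @MeasurePreserving Ω Ω m0 m id μ (μ.trim hm) :=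
  @MeasurePreserving.mk Ω Ω m0 m id μ (μ.trim hm) (measurable_id'' hm) (trim_eq_map hm).symm

/-- The inclusion of `L⁰(F)` in `L⁰(E)` for a sub-σ-algebra `F = m` of `E = m0`; the base of
`L⁰(F)` is `Ω` with the restriction `μ.trim hm` of the probability measure to `m`. -/
noncomputable def L0incl (hm : m ≤ m0) : L0 (μ.trim hm) ℝ →+* L0 μ ℝ :=
  L0comp id (measurePreserving_id_trim hm)

/-- `L⁰(E)` as a module over `L⁰(F)`, by multiplication. -/
noncomputable instance instModuleL0Trim (hm : m ≤ m0) : Module (L0 (μ.trim hm) ℝ) (L0 μ ℝ) :=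
  Module.compHom (L0 μ ℝ) (L0incl hm)

/-- The classes `ξ` of `[0, ∞]`-valued `F`-measurable random variables with `|x| ≤ ξ`. -/
def condMajorants (hm : m ≤ m0) (x : L0 μ ℝ) : Set (L0 (μ.trim hm) ℝ≥0∞) :=
  {ξ | ∀ᵐ ω ∂μ, ‖x ω‖ₑ ≤ L0rep ξ ω}

/-- The infimum of the `F`-measurable majorants of `|x|` exists (and is a majorant). -/
theorem exists_isLeast_condMajorants [IsFiniteMeasure μ] (hm : m ≤ m0) (x : L0 μ ℝ) :
    ∃ ξ, IsLeast (condMajorants hm x) ξ := by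
  refine exists_isLeast_of_iInf_mem _ ⟨L0top _, ?_⟩ fun u hu => ?_
  · filter_upwards [ae_eq_of_ae_eq_trim (L0rep_L0top (μ := μ.trim hm))] with ω h
    rw [h]; exact le_top
  · filter_upwards [ae_eq_of_ae_eq_trim (L0rep_L0mkENN_iInf u), ae_all_iff.2 hu] with ω h1 h2
    rw [h1]; exact le_iInf h2

theorem exists_isGLB_condMajorants [IsFiniteMeasure μ] (hm : m ≤ m0) (x : L0 μ ℝ) :
    ∃ ξ, IsGLB (condMajorants hm x) ξ :=
  (exists_isLeast_condMajorants hm x).imp fun _ h => h.isGLB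

open Classical in
/-- The extended conditional norm `|||x|||_p`, a class of `[0, ∞]`-valued `F`-measurable
random variables: `E[|x|^p | F]^(1/p)` for `p < ∞` and `⋀ {ξ | |x| ≤ ξ}` for `p = ∞`. Here
`condLExp` is the conditional expectation of nonnegative, possibly non-integrable variables. -/
noncomputable def eCondNorm [IsFiniteMeasure μ] (hm : m ≤ m0) (p : ℝ≥0∞) (x : L0 μ ℝ) :
    L0 (μ.trim hm) ℝ≥0∞ :=
  if p = ∞ then (exists_isGLB_condMajorants hm x).choose
  else L0rpow (μ.trim hm) (condLExp m μ fun ω => ‖x ω‖ₑ ^ p.toReal)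
    (measurable_condLExp m μ _) (1 / p.toReal)

/-- `|||x|||_p` is almost surely finite. -/
def CondNormFinite [IsFiniteMeasure μ] (hm : m ≤ m0) (p : ℝ≥0∞) (x : L0 μ ℝ) : Prop :=
  ∀ᵐ ω ∂(μ.trim hm), L0rep (eCondNorm hm p x) ω < ∞

theorem ae_trim_of_measurable (hm : m ≤ m0) {f : Ω → ℝ≥0∞} (hf : Measurable[m] f)
    (h : ∀ᵐ ω ∂μ, f ω < ∞) : ∀ᵐ ω ∂(μ.trim hm), f ω < ∞ := by
  rw [ae_iff] at h ⊢
  exact (trim_measurableSet_eq hm (measurableSet_lt_top_ENN hf).compl).trans h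

theorem condNormFinite_top_iff [IsFiniteMeasure μ] (hm : m ≤ m0) (x : L0 μ ℝ) :
    CondNormFinite hm ∞ x ↔
      ∃ ξ : L0 (μ.trim hm) ℝ≥0∞, ∀ᵐ ω ∂μ, ‖x ω‖ₑ ≤ L0rep ξ ω ∧ L0rep ξ ω < ∞ := by
  have hG := (exists_isGLB_condMajorants hm x).choose_spec
  obtain ⟨ζ, hζ⟩ := exists_isLeast_condMajorants hm x
  have he : eCondNorm hm ∞ x = ζ := by
    rw [eCondNorm, if_pos rfl]; exact hG.unique hζ.isGLB
  rw [CondNormFinite, he]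
  constructor
  · intro h
    refine ⟨ζ, ?_⟩
    filter_upwards [hζ.1, ae_of_ae_trim hm h] with ω h1 h2 using ⟨h1, h2⟩
  · rintro ⟨ξ, h⟩
    have h1 : ζ ≤ ξ := hζ.2 (h.mono fun _ h => h.1)
    have h2 := L0rep_le h1
    have h3 : ∀ᵐ ω ∂(μ.trim hm), L0rep ξ ω < ∞ :=
      ae_trim_of_measurable hm (measurable_L0rep ξ) (h.mono fun _ h => h.2)
    filter_upwards [h2, h3] with ω h4 h5 using h4.trans_lt h5

theorem condNormFinite_iff [IsFiniteMeasure μ] (hm : m ≤ m0) {p : ℝ≥0∞} (hp : p ≠ ∞)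
    (hp0 : p ≠ 0) (x : L0 μ ℝ) :
    CondNormFinite hm p x ↔ ∀ᵐ ω ∂μ, condLExp m μ (fun ω => ‖x ω‖ₑ ^ p.toReal) ω < ∞ := by
  have hq : 0 < 1 / p.toReal := one_div_pos.2 (ENNReal.toReal_pos hp0 hp)
  have h1 := L0rep_L0rpow (μ := μ.trim hm) (condLExp m μ fun ω => ‖x ω‖ₑ ^ p.toReal)
    (measurable_condLExp m μ _) (1 / p.toReal)
  rw [CondNormFinite, eCondNorm, if_neg hp]
  constructor
  · intro h
    filter_upwards [ae_of_ae_trim hm h, ae_of_ae_trim hm h1] with ω h2 h3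
    rw [h3] at h2
    exact (ENNReal.rpow_lt_top_iff_of_pos hq).1 h2
  · intro h
    filter_upwards [ae_trim_of_measurable hm (measurable_condLExp m μ _) h, h1] with ω h2 h3
    rw [h3]
    exact (ENNReal.rpow_lt_top_iff_of_pos hq).2 h2

theorem condNormFinite_exp_zero [IsFiniteMeasure μ] (hm : m ≤ m0) (x : L0 μ ℝ) :
    CondNormFinite hm 0 x := by
  rw [CondNormFinite, eCondNorm, if_neg ENNReal.zero_ne_top]
  filter_upwards [L0rep_L0rpow (μ := μ.trim hm) (condLExp m μ fun ω => ‖x ω‖ₑ ^ (0 : ℝ≥0∞).toReal)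
    (measurable_condLExp m μ _) (1 / (0 : ℝ≥0∞).toReal)] with ω h
  rw [h]; simp

/-- Factors that are measurable with respect to the sub-σ-algebra can be pulled out. -/
theorem condLExp_mul_left [IsFiniteMeasure μ] (hm : m ≤ m0) {a f : Ω → ℝ≥0∞}
    (ha : Measurable[m] a) (hf : AEMeasurable[m0] f μ) :
    condLExp m μ (fun ω => a ω * f ω) =ᵐ[μ] fun ω => a ω * condLExp m μ f ω := by
  symm
  have key : (μ.withDensity f).trim hm = (μ.withDensity (condLExp m μ f)).trim hm := by
    refine @Measure.ext Ω m _ _ fun s hs => ?_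
    rw [trim_measurableSet_eq hm hs, trim_measurableSet_eq hm hs, withDensity_apply _ (hm s hs),
      withDensity_apply _ (hm s hs), setLIntegral_condLExp hm μ f hs]
  refine ae_eq_condLExp hm μ _ (measurable_mul_ENN ha (measurable_condLExp m μ f)) fun s hs => ?_
  have h1 : ∀ g : Ω → ℝ≥0∞, AEMeasurable g μ →
      ∫⁻ ω in s, a ω * g ω ∂μ = ∫⁻ ω in s, a ω ∂((μ.withDensity g).trim hm) := fun g hg => by
    rw [setLIntegral_trim hm ha hs, setLIntegral_withDensity_eq_lintegral_mul₀ hg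
      (ha.mono hm le_rfl).aemeasurable (hm s hs)]
    exact lintegral_congr fun ω => mul_comm _ _
  rw [h1 f hf, h1 _ (measurable_condLExp' m μ f).aemeasurable, key]

theorem enorm_L0_add (x y : L0 μ ℝ) :
    ∀ᵐ ω ∂μ, ‖(x + y) ω‖ₑ ≤ ‖x ω‖ₑ + ‖y ω‖ₑ := by
  filter_upwards [AEEqFun.coeFn_add x y] with ω h
  rw [h]; exact enorm_add_le _ _

theorem enorm_L0_smul (hm : m ≤ m0) (ξ : L0 (μ.trim hm) ℝ) (x : L0 μ ℝ) :
    ∀ᵐ ω ∂μ, ‖(ξ • x) ω‖ₑ = L0rep (L0enorm ξ) ω * ‖x ω‖ₑ := by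
  filter_upwards [AEEqFun.coeFn_mul (L0incl hm ξ) x, coe_L0comp id (measurePreserving_id_trim hm) ξ,
    ae_eq_of_ae_eq_trim (L0rep_L0enorm ξ)] with ω h1 h2 h3
  change ‖(L0incl hm ξ * x) ω‖ₑ = _
  rw [h1, h3, Pi.mul_apply, enorm_mul]
  congr 2

theorem condNormFinite_zero [IsFiniteMeasure μ] (hm : m ≤ m0) (p : ℝ≥0∞) :
    CondNormFinite hm p (0 : L0 μ ℝ) := by
  have h0 := AEEqFun.coeFn_zero (α := Ω) (μ := μ) (β := ℝ)
  by_cases hp : p = ∞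
  · subst hp
    refine (condNormFinite_top_iff hm 0).2 ⟨L0zero _, ?_⟩
    filter_upwards [h0, ae_eq_of_ae_eq_trim (L0rep_L0zero (μ := μ.trim hm))] with ω h1 h2
    rw [h1, h2]; simp
  by_cases hp0 : p = 0
  · subst hp0; exact condNormFinite_exp_zero hm 0
  refine (condNormFinite_iff hm hp hp0 0).2 ?_
  refine condLExp_lt_top (ne_of_eq_of_ne (b := 0) ?_ ENNReal.zero_ne_top)
  refine (lintegral_congr_ae (g := fun _ => 0) ?_).trans lintegral_zero
  filter_upwards [h0] with ω h
  rw [h]; simp [ENNReal.toReal_pos hp0 hp]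

theorem condNormFinite_add [IsFiniteMeasure μ] (hm : m ≤ m0) (p : ℝ≥0∞) {x y : L0 μ ℝ}
    (hx : CondNormFinite hm p x) (hy : CondNormFinite hm p y) :
    CondNormFinite hm p (x + y) := by
  by_cases hp : p = ∞
  · subst hp
    obtain ⟨ξ, hξ⟩ := (condNormFinite_top_iff hm x).1 hx
    obtain ⟨η, hη⟩ := (condNormFinite_top_iff hm y).1 hy
    refine (condNormFinite_top_iff hm _).2 ⟨L0addENN ξ η, ?_⟩
    filter_upwards [hξ, hη, enorm_L0_add x y, ae_eq_of_ae_eq_trim (L0rep_L0addENN ξ η)]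
      with ω h1 h2 h3 h4
    rw [h4]
    exact ⟨h3.trans (add_le_add h1.1 h2.1), ENNReal.add_lt_top.2 ⟨h1.2, h2.2⟩⟩
  by_cases hp0 : p = 0
  · subst hp0; exact condNormFinite_exp_zero hm _
  have hq : 0 < p.toReal := ENNReal.toReal_pos hp0 hp
  have hxm : AEMeasurable (fun ω => ‖x ω‖ₑ ^ p.toReal) μ :=
    ((AEEqFun.aestronglyMeasurable x).enorm).pow_const _
  have hym : AEMeasurable (fun ω => ‖y ω‖ₑ ^ p.toReal) μ :=
    ((AEEqFun.aestronglyMeasurable y).enorm).pow_const _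
  have h1 := (condNormFinite_iff hm hp hp0 x).1 hx
  have h2 := (condNormFinite_iff hm hp hp0 y).1 hy
  refine (condNormFinite_iff hm hp hp0 _).2 ?_
  have hc : (2 : ℝ≥0∞) ^ p.toReal ≠ ∞ := ENNReal.rpow_ne_top_of_nonneg hq.le (by simp)
  have h3 := condLExp_mono (mΩ := m) (P := μ) (X := fun ω => ‖(x + y) ω‖ₑ ^ p.toReal)
    (Y := (2 : ℝ≥0∞) ^ p.toReal • ((fun ω => ‖x ω‖ₑ ^ p.toReal) + fun ω => ‖y ω‖ₑ ^ p.toReal)) (by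
      filter_upwards [enorm_L0_add x y] with ω h
      simp only [Pi.smul_apply, Pi.add_apply, smul_eq_mul]
      calc ‖(x + y) ω‖ₑ ^ p.toReal ≤ (2 * max ‖x ω‖ₑ ‖y ω‖ₑ) ^ p.toReal := by
            refine ENNReal.rpow_le_rpow (h.trans ?_) hq.le
            rw [two_mul]; exact add_le_add (le_max_left _ _) (le_max_right _ _)
        _ = 2 ^ p.toReal * (max ‖x ω‖ₑ ‖y ω‖ₑ) ^ p.toReal := ENNReal.mul_rpow_of_nonneg _ _ hq.le
        _ ≤ _ := by
            gcongr
            rcases le_total ‖x ω‖ₑ ‖y ω‖ₑ with h | h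
            · rw [max_eq_right h]; exact le_add_self
            · rw [max_eq_left h]; exact le_self_add)
  filter_upwards [h1, h2, h3, condLExp_smul' (mΩ := m) (P := μ)
    ((fun ω => ‖x ω‖ₑ ^ p.toReal) + fun ω => ‖y ω‖ₑ ^ p.toReal) hc,
    condLExp_add_left (mΩ := m) (P := μ) (fun ω => ‖y ω‖ₑ ^ p.toReal) hxm] with ω g1 g2 g3 g4 g5
  refine g3.trans_lt ?_
  rw [g4, Pi.smul_apply, g5, smul_eq_mul]
  exact ENNReal.mul_lt_top hc.lt_top (ENNReal.add_lt_top.2 ⟨g1, g2⟩)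

theorem condNormFinite_smul [IsFiniteMeasure μ] (hm : m ≤ m0) (p : ℝ≥0∞)
    (ξ : L0 (μ.trim hm) ℝ) {x : L0 μ ℝ} (hx : CondNormFinite hm p x) :
    CondNormFinite hm p (ξ • x) := by
  have hξ := ae_of_ae_trim hm (L0enorm_lt_top ξ)
  by_cases hp : p = ∞
  · subst hp
    obtain ⟨η, hη⟩ := (condNormFinite_top_iff hm x).1 hx
    refine (condNormFinite_top_iff hm _).2 ⟨L0mulENN (L0enorm ξ) η, ?_⟩
    filter_upwards [hξ, hη, enorm_L0_smul hm ξ x,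
      ae_eq_of_ae_eq_trim (L0rep_L0mulENN (L0enorm ξ) η)] with ω h1 h2 h3 h4
    rw [h4, h3]
    exact ⟨mul_le_mul_right h2.1 _, ENNReal.mul_lt_top h1 h2.2⟩
  by_cases hp0 : p = 0
  · subst hp0; exact condNormFinite_exp_zero hm _
  have hq : 0 < p.toReal := ENNReal.toReal_pos hp0 hp
  have hxm : AEMeasurable (fun ω => ‖x ω‖ₑ ^ p.toReal) μ :=
    ((AEEqFun.aestronglyMeasurable x).enorm).pow_const _
  have h1 := (condNormFinite_iff hm hp hp0 x).1 hx
  refine (condNormFinite_iff hm hp hp0 _).2 ?_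
  have h3 := condLExp_congr_ae (mΩ := m) (P := μ) (X := fun ω => ‖(ξ • x) ω‖ₑ ^ p.toReal)
    (Y := fun ω => L0rep (L0enorm ξ) ω ^ p.toReal * ‖x ω‖ₑ ^ p.toReal) (by
      filter_upwards [enorm_L0_smul hm ξ x] with ω h
      rw [h, ENNReal.mul_rpow_of_nonneg _ _ hq.le])
  filter_upwards [h1, h3, hξ, condLExp_mul_left hm
    (measurable_rpow_ENN (measurable_L0rep (L0enorm ξ)) p.toReal) hxm] with ω g1 g3 g2 g4
  rw [g3, g4]
  exact ENNReal.mul_lt_top (ENNReal.rpow_lt_top_of_nonneg hq.le g2.ne) g1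

/-- `L^p_F(E)`: the classes `x ∈ L⁰(E)` with `|||x|||_p ∈ L⁰₊(F)`, that is, with `|||x|||_p`
finite almost surely; an `L⁰(F)`-submodule of `L⁰(E)`. -/
noncomputable def LpF [IsFiniteMeasure μ] (hm : m ≤ m0) (p : ℝ≥0∞) :
    Submodule (L0 (μ.trim hm) ℝ) (L0 μ ℝ) where
  carrier := {x | CondNormFinite hm p x}
  zero_mem' := condNormFinite_zero hm p
  add_mem' hx hy := condNormFinite_add hm p hx hy
  smul_mem' ξ _ hx := condNormFinite_smul hm p ξ hx

/-- The `L⁰`-norm `|||·|||_p : L^p_F(E) → L⁰₊(F)`. -/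
noncomputable def LpFnorm [IsFiniteMeasure μ] (hm : m ≤ m0) (p : ℝ≥0∞)
    (x : LpF (μ := μ) hm p) : L0 (μ.trim hm) ℝ :=
  L0toReal (eCondNorm hm p (x : L0 μ ℝ))

end LpF

end RandomModule

namespace RandomModule

/-! ### Pointwise calculus of classes, and the exhaustion principle. -/

section Pointwise

variable {Ω : Type*} {m : MeasurableSpace Ω} {μ : Measure Ω}

/-! The model is the classical proof that a barrel in a Banach space has interior: nested balls and
completeness. Here radii are random, `Tc` need not be metrizable, and a failure may occur on part of
`Ω` only. So each step is localised to events and glued by countable concatenation, with maximal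
events supplied by `exists_exhausting`.

Let `B` be a barrel with the countable concatenation property. There is an essentially largest event
`G` on which `B` contains a ball about `0` (`AbsorbsBallOn`); the claim is that `Gᶜ` is null. For
each scale `0 < t ≤ 1`, every ball contains a smaller one such that, for `z` in it, no restriction
of `t z` to a non-null part of `Gᶜ` lies in `B` (`exists_ball_avoids`). Indeed, on an event where
this cannot be arranged, members of `B` come arbitrarily close to `t z` for every `z` in the given
ball. By closedness `B` contains these restrictions (`ind_smul_mem_of_not_avoids`), and by convexity
and balance it contains a ball about `0` there (`absorbsBallOn_of_forall`), so the event is null.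

Nested balls for `t = 1, 1/2, 1/3, ...` have a common point `x`. Absorbency gives `ξ > 0` such that
`x / (n + 1)` belongs to `B` on `{ξ ≥ 1 / (n + 1)}`. These events cover `Ω` up to a null set, which
forces `Gᶜ` to be null.

The only completeness used is `GeometricallyComplete`, since the radii can be kept below `2⁻ⁿ`. For
a `Tc`-complete module it follows by concatenation. For `L^p_F(E)` it is proved directly, from
almost everywhere convergence and a conditional Fatou lemma; the triangle inequality there is a
conditional Minkowski inequality. -/

theorem coe_L0abs {K : Type*} [RCLike K] (ξ : L0 μ K) : ∀ᵐ ω ∂μ, L0abs ξ ω = ‖ξ ω‖ :=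
  AEEqFun.coeFn_comp _ _ _

theorem coe_L0ofReal {K : Type*} [RCLike K] (ξ : L0 μ ℝ) :
    ∀ᵐ ω ∂μ, L0ofReal K ξ ω = (ξ ω : K) :=
  AEEqFun.coeFn_comp _ _ _

theorem coe_L0ind (K : Type*) [RCLike K] {A : Set Ω} (hA : MeasurableSet A) :
    ∀ᵐ ω ∂μ, L0ind μ K A hA ω = A.indicator (fun _ => (1 : K)) ω :=
  AEEqFun.coeFn_mk _ _

theorem L0_ext {β : Type*} [TopologicalSpace β] {ξ η : Ω →ₘ[μ] β} (h : ∀ᵐ ω ∂μ, ξ ω = η ω) :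
    ξ = η := AEEqFun.ext h

theorem L0_le_iff {ξ η : L0 μ ℝ} : ξ ≤ η ↔ ∀ᵐ ω ∂μ, ξ ω ≤ η ω := AEEqFun.coeFn_le.symm

theorem coe_L0_add {R : Type*} [CommRing R] [TopologicalSpace R] [IsTopologicalRing R]
    (ξ η : L0 μ R) : ∀ᵐ ω ∂μ, (ξ + η) ω = ξ ω + η ω := AEEqFun.coeFn_add ξ η

theorem coe_L0_mul {R : Type*} [CommRing R] [TopologicalSpace R] [IsTopologicalRing R]
    (ξ η : L0 μ R) : ∀ᵐ ω ∂μ, (ξ * η) ω = ξ ω * η ω := AEEqFun.coeFn_mul ξ η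

theorem coe_L0_sub {R : Type*} [CommRing R] [TopologicalSpace R] [IsTopologicalRing R]
    (ξ η : L0 μ R) : ∀ᵐ ω ∂μ, (ξ - η) ω = ξ ω - η ω := AEEqFun.coeFn_sub ξ η

theorem coe_L0_neg {R : Type*} [CommRing R] [TopologicalSpace R] [IsTopologicalRing R]
    (ξ : L0 μ R) : ∀ᵐ ω ∂μ, (-ξ) ω = -ξ ω := AEEqFun.coeFn_neg ξ

theorem coe_L0_zero {R : Type*} [CommRing R] [TopologicalSpace R] [IsTopologicalRing R] :
    ∀ᵐ ω ∂μ, (0 : L0 μ R) ω = 0 := AEEqFun.coeFn_zero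

theorem coe_L0_one {R : Type*} [CommRing R] [TopologicalSpace R] [IsTopologicalRing R] :
    ∀ᵐ ω ∂μ, (1 : L0 μ R) ω = 1 := AEEqFun.coeFn_one

/-- The class of a measurable function with values in `ℝ` or `ℂ`. -/
theorem exists_L0_eq {K : Type*} [RCLike K] {f : Ω → K} (hf : Measurable f) :
    ∃ ξ : L0 μ K, ∀ᵐ ω ∂μ, ξ ω = f ω :=
  ⟨AEEqFun.mk f hf.aestronglyMeasurable, AEEqFun.coeFn_mk _ _⟩

theorem exists_L0pp_eq {f : Ω → ℝ} (hf : Measurable f) (hpos : ∀ᵐ ω ∂μ, 0 < f ω) :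
    ∃ ξ ∈ L0pp μ, ∀ᵐ ω ∂μ, ξ ω = f ω := by
  obtain ⟨ξ, hξ⟩ := exists_L0_eq (μ := μ) hf
  refine ⟨ξ, ?_, hξ⟩
  show ∀ᵐ ω ∂μ, 0 < ξ ω
  filter_upwards [hξ, hpos] with ω h1 h2
  rwa [h1]

theorem exists_L0pp_half {ε : L0 μ ℝ} (hε : ε ∈ L0pp μ) :
    ∃ δ ∈ L0pp μ, ∀ᵐ ω ∂μ, δ ω = ε ω / 2 :=
  exists_L0pp_eq ((AEEqFun.measurable ε).div_const 2) (by
    filter_upwards [show ∀ᵐ ω ∂μ, 0 < ε ω from hε] with ω h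
    linarith)

theorem exists_L0pp_min {ε δ : L0 μ ℝ} (hε : ε ∈ L0pp μ) (hδ : δ ∈ L0pp μ) :
    ∃ γ ∈ L0pp μ, ∀ᵐ ω ∂μ, γ ω = min (ε ω) (δ ω) :=
  exists_L0pp_eq ((AEEqFun.measurable ε).min (AEEqFun.measurable δ)) (by
    filter_upwards [show ∀ᵐ ω ∂μ, 0 < ε ω from hε, show ∀ᵐ ω ∂μ, 0 < δ ω from hδ] with ω h h'
    exact lt_min h h')

/-- Concatenation of strictly positive classes along disjoint events. -/
theorem exists_L0pp_concat {A : ℕ → Set Ω} (hA : ∀ n, MeasurableSet (A n))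
    (hd : Pairwise (Function.onFun Disjoint A)) {r : ℕ → L0 μ ℝ} (hr : ∀ n, r n ∈ L0pp μ)
    {s : L0 μ ℝ} (hs : s ∈ L0pp μ) :
    ∃ ξ ∈ L0pp μ, (∀ n, ∀ᵐ ω ∂μ, ω ∈ A n → ξ ω = r n ω) ∧
      ∀ᵐ ω ∂μ, ω ∉ (⋃ n, A n) → ξ ω = s ω := by
  have hpos : ∀ᵐ ω ∂μ, 0 < s ω ∧ ∀ n, 0 < r n ω := by
    filter_upwards [show ∀ᵐ ω ∂μ, 0 < s ω from hs,
      ae_all_iff.2 fun n => show ∀ᵐ ω ∂μ, 0 < r n ω from hr n] with ω h1 h2 using ⟨h1, h2⟩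
  -- The index `none` carries the complement of the union, where `s` is used.
  obtain ⟨f, hf, hfe⟩ := exists_measurable_piecewise
    (fun k : Option ℕ => k.elim (⋃ n, A n)ᶜ A)
    (by rintro (_ | n); exacts [(MeasurableSet.iUnion hA).compl, hA n])
    (fun k : Option ℕ => k.elim (s : Ω → ℝ) fun n => r n)
    (by rintro (_ | n); exacts [AEEqFun.measurable s, AEEqFun.measurable (r n)])
    (by
      rintro (_ | i) (_ | j) hij ω ⟨h1, h2⟩
      · rfl
      · exact absurd (Set.mem_iUnion.2 ⟨j, h2⟩) h1
      · exact absurd (Set.mem_iUnion.2 ⟨i, h1⟩) h2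
      · have : i ≠ j := fun h => hij (by rw [h])
        exact absurd h2 (Set.disjoint_left.1 (hd this) h1))
  obtain ⟨ξ, hξ, hξe⟩ := exists_L0pp_eq (μ := μ) hf (by
    filter_upwards [hpos] with ω h
    by_cases hω : ω ∈ ⋃ n, A n
    · obtain ⟨n, hn⟩ := Set.mem_iUnion.1 hω
      exact (h.2 n).trans_eq (hfe (some n) hn).symm
    · exact h.1.trans_eq (hfe none hω).symm)
  refine ⟨ξ, hξ, fun n => ?_, ?_⟩
  · filter_upwards [hξe] with ω h hω
    rw [h]; exact hfe (some n) hω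
  · filter_upwards [hξe] with ω h hω
    rw [h]; exact hfe none hω

/-- Exhaustion: a hereditary family of events that is closed under countable disjoint unions has
a member such that all members disjoint from it are null. -/
theorem exists_exhausting [IsFiniteMeasure μ] (H : Set Ω → Prop) (h0 : H ∅)
    (hm : ∀ A, H A → MeasurableSet A)
    (hsub : ∀ A B, H A → MeasurableSet B → B ⊆ A → H B)
    (hU : ∀ A : ℕ → Set Ω, (∀ n, H (A n)) → Pairwise (Function.onFun Disjoint A) →
      H (⋃ n, A n)) :
    ∃ A, H A ∧ ∀ B, H B → Disjoint A B → μ B = 0 := by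
  -- The union of a sequence of members whose measures approach the supremum is, after disjointing,
  -- a member that attains it.
  obtain ⟨v, -, hv, hvS⟩ := exists_seq_tendsto_sSup
    (S := μ '' {A | H A}) ⟨_, ∅, h0, rfl⟩ (OrderTop.bddAbove _)
  choose u huS hu using hvS
  have hA : H (⋃ n, u n) := by
    rw [← iUnion_disjointed]
    exact hU _ (fun n => hsub _ _ (huS n) (MeasurableSet.disjointed (fun k => hm _ (huS k)) n)
      (disjointed_subset u n)) (disjoint_disjointed u)
  refine ⟨_, hA, fun B hB hd => ?_⟩
  -- The enlarged event cannot exceed the supremum, so by finiteness of `μ` the event `B` adds no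
  -- mass.
  have hAB : H ((⋃ n, u n) ∪ B) := by
    have : (⋃ n, u n) ∪ B = ⋃ n : ℕ, (fun n => if n = 0 then ⋃ n, u n else if n = 1 then B else ∅) n := by
      ext ω
      simp only [Set.mem_union, Set.mem_iUnion]
      constructor
      · rintro (h | h)
        · exact ⟨0, by simpa using h⟩
        · exact ⟨1, by simpa using h⟩
      · rintro ⟨n, h⟩
        split_ifs at h
        · exact Or.inl (Set.mem_iUnion.1 h)
        · exact Or.inr h
        · exact h.elim
    rw [this]
    refine hU _ (fun n => ?_) fun i j hij => ?_
    · split_ifs <;> assumption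
    · rw [Function.onFun_apply]
      have := hd.symm
      split_ifs <;> first | omega | simp [*]
  have h1 : μ (⋃ n, u n) + μ B ≤ μ (⋃ n, u n) := by
    rw [← measure_union hd (hm _ hB)]
    refine (le_sSup ⟨_, hAB, rfl⟩ : _ ≤ sSup (μ '' {A | H A})).trans
      (le_of_tendsto hv (Filter.Eventually.of_forall fun n => ?_))
    rw [← hu n]
    exact measure_mono (Set.subset_iUnion u n)
  by_contra hB0
  exact absurd h1 (not_le.2 (ENNReal.lt_add_right (measure_ne_top _ _) hB0))

end Pointwise

/-! ### Indicators, locality of the `L⁰`-norm, and neighbourhoods. -/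

section Norm

variable {Ω : Type*} {m : MeasurableSpace Ω} {μ : Measure Ω} {E : Type*} [AddCommGroup E]
  {K : Type*} [RCLike K] [Module (L0 μ K) E] {N : E → L0 μ ℝ}

theorem L0ind_mul {A B C : Set Ω} (hA : MeasurableSet A) (hB : MeasurableSet B)
    (hC : MeasurableSet C) (h : A ∩ B = C) : L0ind μ K A hA * L0ind μ K B hB = L0ind μ K C hC := by
  refine L0_ext ?_
  filter_upwards [coe_L0ind (μ := μ) K hA, coe_L0ind (μ := μ) K hB, coe_L0ind (μ := μ) K hC,
    coe_L0_mul (L0ind μ K A hA) (L0ind μ K B hB)] with ω h1 h2 h3 h4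
  rw [h4, h1, h2, h3, ← h]
  by_cases hωA : ω ∈ A <;> by_cases hωB : ω ∈ B <;> simp [hωA, hωB]

theorem L0ind_smul_smul_of_subset {A B : Set Ω} (hA : MeasurableSet A) (hB : MeasurableSet B)
    (h : A ⊆ B) (x : E) : L0ind μ K A hA • L0ind μ K B hB • x = L0ind μ K A hA • x := by
  rw [smul_smul, L0ind_mul hA hB hA (Set.inter_eq_left.2 h)]

theorem L0abs_L0ind_le {A : Set Ω} (hA : MeasurableSet A) : L0abs (L0ind μ K A hA) ≤ 1 := by
  rw [L0_le_iff]
  filter_upwards [coe_L0abs (L0ind μ K A hA), coe_L0ind (μ := μ) K hA,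
    coe_L0_one (μ := μ) (R := ℝ)] with ω h1 h2 h3
  rw [h1, h2, h3]
  by_cases hωA : ω ∈ A <;> simp [hωA]

theorem IsL0Balanced.ind_smul {B : Set E} (hB : IsL0Balanced μ K B) {A : Set Ω}
    (hA : MeasurableSet A) {x : E} (hx : x ∈ B) : L0ind μ K A hA • x ∈ B :=
  hB _ (L0abs_L0ind_le hA) x hx

theorem L0_zero_smul (x : E) : (0 : L0 μ K) • x = 0 := zero_smul (L0 μ K) x

theorem IsL0Balanced.zero_mem {B : Set E} (hB : IsL0Balanced μ K B) (hne : B.Nonempty) :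
    (0 : E) ∈ B := by
  obtain ⟨x, hx⟩ := hne
  have := hB 0 (by
    rw [L0_le_iff]
    filter_upwards [coe_L0abs (0 : L0 μ K), coe_L0_zero (μ := μ) (R := K),
      coe_L0_one (μ := μ) (R := ℝ)] with ω h1 h2 h3
    rw [h1, h2, h3]; simp) x hx
  rwa [L0_zero_smul] at this

theorem IsL0Balanced.neg_mem {B : Set E} (hB : IsL0Balanced μ K B) {x : E} (hx : x ∈ B) :
    -x ∈ B := by
  have := hB (-1) (by
    rw [L0_le_iff]
    filter_upwards [coe_L0abs (-1 : L0 μ K), coe_L0_neg (1 : L0 μ K), coe_L0_one (μ := μ) (R := K),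
      coe_L0_one (μ := μ) (R := ℝ)] with ω h1 h2 h3 h4
    rw [h1, h2, h3, h4]; simp) x hx
  rwa [neg_one_smul] at this

theorem IsL0Absorbent.nonempty {B : Set E} (hB : IsL0Absorbent μ K B) : B.Nonempty := by
  obtain ⟨ξ, hξ, h⟩ := hB 0
  refine ⟨_, h 0 ?_ 0 rfl⟩
  rw [L0_le_iff]
  filter_upwards [coe_L0abs (0 : L0 μ K), coe_L0_zero (μ := μ) (R := K),
    show ∀ᵐ ω ∂μ, 0 < ξ ω from hξ] with ω h1 h2 h3
  rw [h1, h2]; simpa using h3.le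

namespace IsL0Norm

theorem coe_nonneg (hN : IsL0Norm K N) (x : E) : ∀ᵐ ω ∂μ, 0 ≤ N x ω := by
  filter_upwards [L0_le_iff.1 (hN.nonneg x), coe_L0_zero (μ := μ) (R := ℝ)] with ω h1 h2
  rwa [h2] at h1

theorem coe_add_le (hN : IsL0Norm K N) (x y : E) : ∀ᵐ ω ∂μ, N (x + y) ω ≤ N x ω + N y ω := by
  filter_upwards [L0_le_iff.1 (hN.add_le x y), coe_L0_add (N x) (N y)] with ω h1 h2
  rwa [h2] at h1

theorem coe_smul (hN : IsL0Norm K N) (ξ : L0 μ K) (x : E) :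
    ∀ᵐ ω ∂μ, N (ξ • x) ω = ‖ξ ω‖ * N x ω := by
  filter_upwards [coe_L0_mul (L0abs ξ) (N x), coe_L0abs ξ] with ω h1 h2
  rw [hN.smul, h1, h2]

theorem coe_zero (hN : IsL0Norm K N) : ∀ᵐ ω ∂μ, N 0 ω = 0 := by
  filter_upwards [hN.coe_smul 0 0, coe_L0_zero (μ := μ) (R := K)] with ω h1 h2
  rw [L0_zero_smul] at h1
  rw [h1, h2, norm_zero, zero_mul]

theorem coe_neg (hN : IsL0Norm K N) (x : E) : ∀ᵐ ω ∂μ, N (-x) ω = N x ω := by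
  filter_upwards [hN.coe_smul (-1) x, coe_L0_neg (1 : L0 μ K), coe_L0_one (μ := μ) (R := K)]
    with ω h1 h2 h3
  rw [neg_one_smul] at h1
  rw [h1, h2, h3, norm_neg, norm_one, one_mul]

theorem coe_sub_comm (hN : IsL0Norm K N) (x y : E) : ∀ᵐ ω ∂μ, N (x - y) ω = N (y - x) ω := by
  have := hN.coe_neg (y - x)
  rwa [neg_sub] at this

theorem coe_sub_le (hN : IsL0Norm K N) (x y z : E) :
    ∀ᵐ ω ∂μ, N (x - z) ω ≤ N (x - y) ω + N (y - z) ω := by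
  have := hN.coe_add_le (x - y) (y - z)
  rwa [sub_add_sub_cancel] at this

theorem coe_sub_self (hN : IsL0Norm K N) (x : E) : ∀ᵐ ω ∂μ, N (x - x) ω = 0 := by
  rw [sub_self]; exact hN.coe_zero

theorem ext (hN : IsL0Norm K N) {x y : E} (h : ∀ᵐ ω ∂μ, N (x - y) ω ≤ 0) : x = y := by
  refine sub_eq_zero.1 (hN.eq_zero _ (L0_ext ?_))
  filter_upwards [h, hN.coe_nonneg (x - y), coe_L0_zero (μ := μ) (R := ℝ)] with ω h1 h2 h3
  rw [h3]; exact le_antisymm h1 h2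

theorem coe_ind_smul (hN : IsL0Norm K N) {A : Set Ω} (hA : MeasurableSet A) (x : E) :
    ∀ᵐ ω ∂μ, N (L0ind μ K A hA • x) ω = A.indicator (N x) ω := by
  filter_upwards [hN.coe_smul (L0ind μ K A hA) x, coe_L0ind (μ := μ) K hA] with ω h1 h2
  rw [h1, h2]
  by_cases hω : ω ∈ A <;> simp [hω]

/-- Since `N (1_A x) = 1_A N x`, the norm is local. Glued elements are compared with their pieces
through this fact. -/
theorem coe_eq_of_ind_smul_eq (hN : IsL0Norm K N) {A : Set Ω} (hA : MeasurableSet A) {x y : E}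
    (h : L0ind μ K A hA • x = L0ind μ K A hA • y) : ∀ᵐ ω ∂μ, ω ∈ A → N x ω = N y ω := by
  filter_upwards [hN.coe_ind_smul hA x, hN.coe_ind_smul hA y] with ω h1 h2 hω
  rw [h, h2] at h1
  simpa [hω] using h1.symm

theorem coe_sub_eq_of_ind_smul_eq (hN : IsL0Norm K N) {A : Set Ω} (hA : MeasurableSet A)
    {x y : E} (h : L0ind μ K A hA • x = L0ind μ K A hA • y) (z : E) :
    ∀ᵐ ω ∂μ, ω ∈ A → N (x - z) ω = N (y - z) ω :=
  hN.coe_eq_of_ind_smul_eq hA (by rw [smul_sub, smul_sub, h])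

/-- The definition of `Tc` only names open sets; that balls are neighbourhoods needs the triangle
inequality. The points having some ball inside `U` form an open set, by halving the radius. -/
theorem mem_nhds_Tc (hN : IsL0Norm K N) {U : Set E} {x : E} :
    U ∈ @nhds E (Tc N) x ↔ ∃ ε ∈ L0pp μ, ∀ y, N (y - x) ≤ ε → y ∈ U := by
  let := Tc N
  rw [mem_nhds_iff]
  constructor
  · rintro ⟨t, htU, ht, hx⟩
    obtain ⟨ε, hε, h⟩ := ht x hx
    exact ⟨ε, hε, fun y hy => htU (h y hy)⟩
  · rintro ⟨ε, hε, h⟩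
    refine ⟨{y | ∃ δ ∈ L0pp μ, ∀ z, N (z - y) ≤ δ → z ∈ U}, ?_, ?_, ⟨ε, hε, h⟩⟩
    · rintro y ⟨δ, hδ, hy⟩
      refine hy y ?_
      rw [L0_le_iff]
      filter_upwards [hN.coe_sub_self y, show ∀ᵐ ω ∂μ, 0 < δ ω from hδ] with ω h1 h2
      rw [h1]; exact h2.le
    · rintro y ⟨δ, hδ, hy⟩
      obtain ⟨γ, hγ, hγδ⟩ := exists_L0pp_half hδ
      refine ⟨γ, hγ, fun y' hy' => ⟨γ, hγ, fun z hz => hy z ?_⟩⟩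
      rw [L0_le_iff] at hy' hz ⊢
      filter_upwards [hy', hz, hγδ, hN.coe_sub_le z y' y] with ω h1 h2 h3 h4
      linarith

theorem ball_mem_nhds_Tc (hN : IsL0Norm K N) {ε : L0 μ ℝ} (hε : ε ∈ L0pp μ) (x : E) :
    {y | N (y - x) ≤ ε} ∈ @nhds E (Tc N) x :=
  hN.mem_nhds_Tc.2 ⟨ε, hε, fun _ h => h⟩

end IsL0Norm

/-- Concatenation along disjoint events that need not cover `Ω`. -/
theorem HasCountableConcat.exists_concat {G : Set E} (hG : HasCountableConcat μ K G)
    {A : ℕ → Set Ω} (hA : ∀ n, MeasurableSet (A n)) (hd : Pairwise (Function.onFun Disjoint A))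
    {x : ℕ → E} (hx : ∀ n, x n ∈ G) {z : E} (hz : z ∈ G) :
    ∃ y ∈ G, (∀ n, L0ind μ K (A n) (hA n) • y = L0ind μ K (A n) (hA n) • x n) ∧
      L0ind μ K (⋃ n, A n)ᶜ (MeasurableSet.iUnion hA).compl • y =
        L0ind μ K (⋃ n, A n)ᶜ (MeasurableSet.iUnion hA).compl • z := by
  -- Index `0` carries the complement with the element `z`; index `n + 1` carries `A n` with `x n`.
  have hA' : ∀ n, MeasurableSet (Nat.casesOn n (⋃ n, A n)ᶜ A : Set Ω) := by
    rintro (_ | n); exacts [(MeasurableSet.iUnion hA).compl, hA n]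
  obtain ⟨y, hy, h⟩ := hG (fun n => Nat.casesOn n (⋃ n, A n)ᶜ A) hA' (by
      rintro (_ | i) (_ | j) hij
      · exact absurd rfl hij
      · exact Set.disjoint_left.2 fun ω h1 h2 => h1 (Set.mem_iUnion.2 ⟨j, h2⟩)
      · exact Set.disjoint_left.2 fun ω h1 h2 => h2 (Set.mem_iUnion.2 ⟨i, h1⟩)
      · exact hd fun h => hij (by rw [h]))
    (by
      refine Set.eq_univ_of_forall fun ω => Set.mem_iUnion.2 ?_
      by_cases hω : ω ∈ ⋃ n, A n
      · obtain ⟨n, hn⟩ := Set.mem_iUnion.1 hω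
        exact ⟨n + 1, hn⟩
      · exact ⟨0, hω⟩)
    (fun n => Nat.casesOn n z x) (by rintro (_ | n); exacts [hz, hx n])
  exact ⟨y, hy, fun n => h (n + 1), h 0⟩

end Norm

/-! ### The topology `Tc` is locally `L⁰`-convex. -/

section LocallyConvex

variable {Ω : Type*} {m : MeasurableSpace Ω} {μ : Measure Ω} {E : Type*} [AddCommGroup E]
  {K : Type*} [RCLike K] [Module (L0 μ K) E] {N : E → L0 μ ℝ}

/-- With this, neighbourhoods of scalars are also described by `mem_nhds_Tc`. -/
theorem isL0Norm_L0abs : IsL0Norm (E := L0 μ K) K (L0abs (μ := μ) (K := K)) where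
  nonneg x := by
    rw [L0_le_iff]
    filter_upwards [coe_L0abs x, coe_L0_zero (μ := μ) (R := ℝ)] with ω h1 h2
    rw [h1, h2]; exact norm_nonneg _
  eq_zero x hx := by
    refine L0_ext ?_
    have hx' : ∀ᵐ ω ∂μ, L0abs x ω = (0 : L0 μ ℝ) ω := by rw [hx]; exact ae_of_all _ fun _ => rfl
    filter_upwards [coe_L0abs x, coe_L0_zero (μ := μ) (R := ℝ), coe_L0_zero (μ := μ) (R := K), hx']
      with ω h1 h2 h3 h4
    rw [h2, h1] at h4
    rw [h3]; exact norm_eq_zero.1 h4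
  add_le x y := by
    rw [L0_le_iff]
    filter_upwards [coe_L0abs (x + y), coe_L0_add x y, coe_L0_add (L0abs x) (L0abs y),
      coe_L0abs x, coe_L0abs y] with ω h1 h2 h3 h4 h5
    rw [h1, h2, h3, h4, h5]; exact norm_add_le _ _
  smul ξ x := by
    refine L0_ext ?_
    rw [smul_eq_mul]
    filter_upwards [coe_L0abs (ξ * x), coe_L0_mul ξ x, coe_L0_mul (L0abs ξ) (L0abs x),
      coe_L0abs x, coe_L0abs ξ] with ω h1 h2 h3 h4 h5
    rw [h1, h2, h3, h4, h5]; exact norm_mul _ _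

namespace IsL0Norm

theorem continuousAdd_Tc (hN : IsL0Norm K N) : @ContinuousAdd E (Tc N) _ := by
  let := Tc N
  refine ⟨continuous_iff_continuousAt.2 fun ⟨x, y⟩ => ?_⟩
  intro U hU
  obtain ⟨ε, hε, h⟩ := hN.mem_nhds_Tc.1 hU
  obtain ⟨δ, hδ, hδε⟩ := exists_L0pp_half hε
  rw [Filter.mem_map]
  refine Filter.mem_of_superset
    (prod_mem_nhds (hN.ball_mem_nhds_Tc hδ x) (hN.ball_mem_nhds_Tc hδ y)) ?_
  rintro ⟨x', y'⟩ ⟨hx, hy⟩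
  refine h _ ?_
  change N (x' - x) ≤ δ at hx
  change N (y' - y) ≤ δ at hy
  rw [L0_le_iff] at hx hy ⊢
  have := hN.coe_add_le (x' - x) (y' - y)
  rw [sub_add_sub_comm] at this
  filter_upwards [hx, hy, hδε, this] with ω h1 h2 h3 h4
  linarith

theorem continuousSMul_Tc (hN : IsL0Norm K N) :
    @ContinuousSMul (L0 μ K) E _ (Tc (L0abs (μ := μ) (K := K))) (Tc N) := by
  let := Tc N
  let := Tc (L0abs (μ := μ) (K := K))
  have hA := isL0Norm_L0abs (μ := μ) (K := K)
  refine ⟨continuous_iff_continuousAt.2 fun ⟨ξ, x⟩ => ?_⟩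
  intro U hU
  obtain ⟨ε, hε, h⟩ := hN.mem_nhds_Tc.1 hU
  have hε' : ∀ᵐ ω ∂μ, 0 < ε ω := hε
  -- The radii come from `η y - ξ x = η (y - x) + (η - ξ) x`. The `min` with `1` gives `|η| ≤ 1 +
  -- |ξ|`, and then each summand is at most `ε / 2`.
  obtain ⟨δ, hδ, hδe⟩ := exists_L0pp_eq (μ := μ)
    (f := fun ω => min 1 (ε ω / (2 * (1 + N x ω))))
    (measurable_const.min ((AEEqFun.measurable ε).div
      (measurable_const.mul (measurable_const.add (AEEqFun.measurable (N x)))))) (by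
    filter_upwards [hε', hN.coe_nonneg x] with ω h1 h2
    positivity)
  obtain ⟨γ, hγ, hγe⟩ := exists_L0pp_eq (μ := μ)
    (f := fun ω => ε ω / (2 * (1 + ‖ξ ω‖)))
    ((AEEqFun.measurable ε).div
      (measurable_const.mul (measurable_const.add (AEEqFun.measurable ξ).norm))) (by
    filter_upwards [hε'] with ω h1
    positivity)
  rw [Filter.mem_map]
  refine Filter.mem_of_superset
    (prod_mem_nhds (hA.ball_mem_nhds_Tc hδ ξ) (hN.ball_mem_nhds_Tc hγ x)) ?_
  rintro ⟨η, y⟩ ⟨hη, hy⟩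
  refine h _ ?_
  change L0abs (η - ξ) ≤ δ at hη
  change N (y - x) ≤ γ at hy
  rw [L0_le_iff] at hη hy ⊢
  have h0 := hN.coe_add_le (η • (y - x)) ((η - ξ) • x)
  have e : η • (y - x) + (η - ξ) • x = η • y - ξ • x := by module
  rw [e] at h0
  filter_upwards [hη, hy, hδe, hγe, h0, hN.coe_smul η (y - x), hN.coe_smul (η - ξ) x,
    coe_L0abs (η - ξ), coe_L0_sub η ξ, hN.coe_nonneg x, hN.coe_nonneg (y - x), hε']
    with ω h1 h2 h3 h4 h5 h6 h7 h8 h9 h10 h11 h12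
  rw [h8, h3] at h1
  rw [h4] at h2
  rw [h6, h7] at h5
  have h13 : ‖η ω‖ ≤ 1 + ‖ξ ω‖ := by
    have := norm_add_le (ξ ω) (η ω - ξ ω)
    rw [add_sub_cancel, ← h9] at this
    linarith [h1.trans (min_le_left _ _)]
  have h14 : ‖η ω‖ * N (y - x) ω ≤ ε ω / 2 :=
    calc ‖η ω‖ * N (y - x) ω ≤ (1 + ‖ξ ω‖) * (ε ω / (2 * (1 + ‖ξ ω‖))) := by gcongr
      _ = ε ω / 2 := by field_simp
  have h15 : ‖(η - ξ) ω‖ * N x ω ≤ ε ω / 2 :=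
    calc ‖(η - ξ) ω‖ * N x ω ≤ ε ω / (2 * (1 + N x ω)) * (1 + N x ω) := by
          gcongr
          · exact h1.trans (min_le_right _ _)
          · linarith
      _ = ε ω / 2 := by field_simp
  linarith

theorem isL0Balanced_ball (hN : IsL0Norm K N) (ε : L0 μ ℝ) :
    IsL0Balanced μ K {x | N x ≤ ε} := by
  intro η hη x hx
  change N x ≤ ε at hx
  change N (η • x) ≤ ε
  rw [L0_le_iff] at hη hx ⊢
  filter_upwards [hη, hx, hN.coe_smul η x, coe_L0abs η, coe_L0_one (μ := μ) (R := ℝ),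
    hN.coe_nonneg x] with ω h1 h2 h3 h4 h5 h6
  rw [h4, h5] at h1
  rw [h3]
  exact (mul_le_of_le_one_left h6 h1).trans h2

theorem isL0Absorbent_ball (hN : IsL0Norm K N) {ε : L0 μ ℝ} (hε : ε ∈ L0pp μ) :
    IsL0Absorbent μ K {x | N x ≤ ε} := by
  intro x
  obtain ⟨ξ, hξ, hξe⟩ := exists_L0pp_eq (μ := μ) (f := fun ω => ε ω / (1 + N x ω))
    ((AEEqFun.measurable ε).div (measurable_const.add (AEEqFun.measurable (N x)))) (by
    filter_upwards [show ∀ᵐ ω ∂μ, 0 < ε ω from hε, hN.coe_nonneg x] with ω h1 h2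
    positivity)
  refine ⟨ξ, hξ, fun η hη a ha => ?_⟩
  rw [Set.mem_singleton_iff] at ha
  rw [ha]
  change N (η • x) ≤ ε
  rw [L0_le_iff] at hη ⊢
  filter_upwards [hη, hξe, hN.coe_smul η x, coe_L0abs η, hN.coe_nonneg x,
    show ∀ᵐ ω ∂μ, 0 < ε ω from hε] with ω h1 h2 h3 h4 h5 h6
  rw [h4, h2] at h1
  rw [h3]
  calc ‖η ω‖ * N x ω ≤ ε ω / (1 + N x ω) * (1 + N x ω) := by gcongr; linarith
    _ = ε ω := by field_simp

theorem isL0Convex_ball (hN : IsL0Norm K N) (ε : L0 μ ℝ) : IsL0Convex μ K {x | N x ≤ ε} := by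
  intro x hx y hy ξ h0 h1
  change N x ≤ ε at hx
  change N y ≤ ε at hy
  change N _ ≤ ε
  rw [L0_le_iff] at hx hy h0 h1 ⊢
  filter_upwards [hx, hy, h0, h1, hN.coe_add_le (L0ofReal K ξ • x) ((1 - L0ofReal K ξ) • y),
    hN.coe_smul (L0ofReal K ξ) x, hN.coe_smul (1 - L0ofReal K ξ) y, coe_L0ofReal (K := K) ξ,
    coe_L0_sub 1 (L0ofReal K ξ), coe_L0_one (μ := μ) (R := ℝ), coe_L0_one (μ := μ) (R := K),
    coe_L0_zero (μ := μ) (R := ℝ)]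
    with ω g1 g2 g3 g4 g5 g6 g7 g8 g9 g10 g11 g12
  rw [g10] at g4
  rw [g12] at g3
  have e : (1 : K) - (ξ ω : K) = ((1 - ξ ω : ℝ) : K) := by push_cast; rfl
  rw [g6, g7, g9, g11, g8, e, RCLike.norm_ofReal, RCLike.norm_ofReal, abs_of_nonneg g3,
    abs_of_nonneg (sub_nonneg.2 g4)] at g5
  nlinarith [sub_nonneg.2 g4]

theorem isLocallyL0ConvexModule_Tc (hN : IsL0Norm K N) : IsLocallyL0ConvexModule μ K (Tc N) where
  continuousAdd := hN.continuousAdd_Tc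
  continuousSMul := hN.continuousSMul_Tc
  localBase U hU := by
    obtain ⟨ε, hε, h⟩ := hN.mem_nhds_Tc.1 hU
    refine ⟨{x | N x ≤ ε}, ?_, fun x hx => h x ?_, hN.isL0Balanced_ball ε,
      hN.isL0Absorbent_ball hε, hN.isL0Convex_ball ε⟩
    · simpa using hN.ball_mem_nhds_Tc hε 0
    · rwa [sub_zero]

end IsL0Norm

end LocallyConvex

/-! ### Completeness along geometrically Cauchy sequences. -/

section Completeness

variable {Ω : Type*} {m : MeasurableSpace Ω} {μ : Measure Ω} {E : Type*} [AddCommGroup E]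
  {K : Type*} [RCLike K] [Module (L0 μ K) E] {N : E → L0 μ ℝ}

/-- Sequences whose increments are bounded by the constants `2⁻ⁿ` converge, uniformly. -/
def GeometricallyComplete (N : E → L0 μ ℝ) : Prop :=
  ∀ x : ℕ → E, (∀ n, ∀ᵐ ω ∂μ, N (x (n + 1) - x n) ω ≤ (1 / 2 : ℝ) ^ n) →
    ∃ y, ∀ n, ∀ᵐ ω ∂μ, N (y - x n) ω ≤ 2 * (1 / 2 : ℝ) ^ n

/-- The tail `2 · 2⁻ⁿ` is kept on the left so that the induction closes: it pays for the next
increment and the next tail. -/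
theorem IsL0Norm.coe_sub_le_of_geometric (hN : IsL0Norm K N) {x : ℕ → E}
    (hx : ∀ n, ∀ᵐ ω ∂μ, N (x (n + 1) - x n) ω ≤ (1 / 2 : ℝ) ^ n) {k n : ℕ} (hkn : k ≤ n) :
    ∀ᵐ ω ∂μ, N (x n - x k) ω + 2 * (1 / 2 : ℝ) ^ n ≤ 2 * (1 / 2 : ℝ) ^ k := by
  induction n, hkn using Nat.le_induction with
  | base =>
    filter_upwards [hN.coe_sub_self (x k)] with ω h
    rw [h, zero_add]
  | succ n _ ih =>
    filter_upwards [ih, hx n, hN.coe_sub_le (x (n + 1)) (x n) (x k)] with ω h1 h2 h3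
    rw [pow_succ]
    linarith

/-- Such a sequence need not be `Tc`-Cauchy, because a random radius can come arbitrarily close to
`0`. It is replaced by the filter generated by the sets `S ε` of elements that lie within `ε` of
being a limit; these are nonempty by concatenation, and the filter is `Tc`-Cauchy. -/
theorem IsL0Norm.geometricallyComplete (hN : IsL0Norm K N) (hc : IsTopComplete (Tc N))
    (hcc : HasCountableConcat μ K (Set.univ : Set E)) : GeometricallyComplete N := by
  intro x hx
  let S : L0 μ ℝ → Set E := fun ε => {y | ∀ n, ∀ᵐ ω ∂μ, N (y - x n) ω ≤ ε ω + 2 * (1 / 2 : ℝ) ^ n}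
  have hSne : ∀ ε ∈ L0pp μ, (S ε).Nonempty := by
    intro ε hε
    -- The member of `S ε` equals `x n` where `n` is the first index with `2 · 2⁻ⁿ ≤ ε`; such an
    -- index exists almost everywhere.
    let A : ℕ → Set Ω := fun n => {ω | 0 < ε ω ∧ 2 * (1 / 2 : ℝ) ^ n ≤ ε ω}
    have hA : ∀ n, MeasurableSet (A n) := fun n =>
      (measurableSet_lt measurable_const (AEEqFun.measurable ε)).inter
        (measurableSet_le measurable_const (AEEqFun.measurable ε))
    obtain ⟨y, -, hy, -⟩ := hcc.exists_concat (fun n => MeasurableSet.disjointed hA n)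
      (disjoint_disjointed A) (x := x) (fun _ => trivial) (z := 0) trivial
    have hcov : ∀ᵐ ω ∂μ, ∃ n, ω ∈ disjointed A n := by
      filter_upwards [show ∀ᵐ ω ∂μ, 0 < ε ω from hε] with ω h
      have : ω ∈ ⋃ n, disjointed A n := by
        rw [iUnion_disjointed]
        obtain ⟨n, hn⟩ := exists_pow_lt_of_lt_one (half_pos h) (by norm_num : (1 / 2 : ℝ) < 1)
        exact Set.mem_iUnion.2 ⟨n, h, by linarith⟩
      exact Set.mem_iUnion.1 this
    refine ⟨y, fun k => ?_⟩
    have h1 : ∀ n, ∀ᵐ ω ∂μ, ω ∈ disjointed A n → N (y - x k) ω = N (x n - x k) ω := fun n =>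
      hN.coe_sub_eq_of_ind_smul_eq _ (hy n) _
    have h2 : ∀ n, ∀ᵐ ω ∂μ, 2 * (1 / 2 : ℝ) ^ n ≤ ε ω →
        N (x n - x k) ω ≤ ε ω + 2 * (1 / 2 : ℝ) ^ k := by
      intro n
      rcases le_total k n with hkn | hkn
      · filter_upwards [hN.coe_sub_le_of_geometric hx hkn] with ω h hω
        have : (0 : ℝ) < (1 / 2 : ℝ) ^ n := by positivity
        linarith
      · filter_upwards [hN.coe_sub_le_of_geometric hx hkn, hN.coe_sub_comm (x n) (x k)]
          with ω h h' hω
        have : (0 : ℝ) < (1 / 2 : ℝ) ^ k := by positivity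
        linarith
    filter_upwards [hcov, ae_all_iff.2 h1, ae_all_iff.2 h2] with ω ⟨n, hn⟩ g1 g2
    rw [g1 n hn]
    exact g2 n (disjointed_subset A n hn).2
  obtain ⟨ε₁, hε₁, -⟩ := exists_L0pp_eq (μ := μ) (f := fun _ => (1 : ℝ)) measurable_const
    (ae_of_all _ fun _ => one_pos)
  have hbasis : Filter.HasBasis (⨅ ε ∈ L0pp μ, Filter.principal (S ε)) (fun ε => ε ∈ L0pp μ) S := by
    refine Filter.hasBasis_biInf_principal ?_ ⟨ε₁, hε₁⟩
    intro ε hε δ hδ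
    obtain ⟨γ, hγ, hγe⟩ := exists_L0pp_min hε hδ
    refine ⟨γ, hγ, fun y hy n => ?_, fun y hy n => ?_⟩
    · filter_upwards [hγe, hy n] with ω h1 h2
      linarith [h1.trans_le (min_le_left _ _)]
    · filter_upwards [hγe, hy n] with ω h1 h2
      linarith [h1.trans_le (min_le_right _ _)]
  obtain ⟨y, hy⟩ := hc (⨅ ε ∈ L0pp μ, Filter.principal (S ε))
    (hbasis.neBot_iff.2 fun {ε} hε => hSne ε hε) (by
      intro U hU
      obtain ⟨ε, hε, h⟩ := hN.mem_nhds_Tc.1 hU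
      obtain ⟨δ, hδ, hδe⟩ := exists_L0pp_half hε
      refine ⟨S δ, hbasis.mem_of_mem hδ, fun a ha b hb => h _ ?_⟩
      rw [sub_zero, L0_le_iff]
      filter_upwards [ae_all_iff.2 ha, ae_all_iff.2 hb, hδe,
        ae_all_iff.2 fun n => hN.coe_sub_le b (x n) a, ae_all_iff.2 fun n => hN.coe_sub_comm (x n) a]
        with ω g1 g2 g3 g4 g5
      have ht : Filter.Tendsto (fun n : ℕ => ε ω + 4 * (1 / 2 : ℝ) ^ n) Filter.atTop
          (nhds (ε ω + 4 * 0)) :=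
        ((tendsto_pow_atTop_nhds_zero_of_lt_one (by norm_num) (by norm_num)).const_mul 4).const_add _
      rw [mul_zero, add_zero] at ht
      refine ge_of_tendsto' ht fun n => ?_
      linarith [g1 n, g2 n, g4 n, g5 n])
  refine ⟨y, fun n => ?_⟩
  -- For `ε = 1 / (k + 1)` take `z` in `S ε` within `ε` of `y`: one `ε` for the distance to `y`, one
  -- for the definition of `S ε`.
  have h1 : ∀ k : ℕ, ∀ᵐ ω ∂μ, N (y - x n) ω ≤ 2 * (1 / 2 : ℝ) ^ n + 2 / ((k : ℝ) + 1) := by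
    intro k
    obtain ⟨ε, hε, hεe⟩ := exists_L0pp_eq (μ := μ) (f := fun _ => 1 / ((k : ℝ) + 1))
      measurable_const (ae_of_all _ fun _ => by positivity)
    obtain ⟨z, hz1, hz2⟩ := ((hbasis.neBot_iff.2 fun {ε} hε => hSne ε hε).nonempty_of_mem
      (Filter.inter_mem (hbasis.mem_of_mem hε) (hy (hN.ball_mem_nhds_Tc hε y))) : Set.Nonempty _)
    change N (z - y) ≤ ε at hz2
    rw [L0_le_iff] at hz2
    filter_upwards [hz1 n, hz2, hεe, hN.coe_sub_le y z (x n), hN.coe_sub_comm y z]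
      with ω g1 g2 g3 g4 g5
    have : 2 / ((k : ℝ) + 1) = 1 / ((k : ℝ) + 1) + 1 / ((k : ℝ) + 1) := by ring
    linarith
  filter_upwards [ae_all_iff.2 h1] with ω h
  have ht : Filter.Tendsto (fun k : ℕ => 2 * (1 / 2 : ℝ) ^ n + 2 * (1 / ((k : ℝ) + 1)))
      Filter.atTop (nhds (2 * (1 / 2 : ℝ) ^ n + 2 * 0)) :=
    (tendsto_one_div_add_atTop_nhds_zero_nat.const_mul 2).const_add _
  rw [mul_zero, add_zero] at ht
  refine ge_of_tendsto' ht fun k => (h k).trans_eq ?_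
  ring

end Completeness

/-! ### Barrels restricted to events. -/

section Barrel

variable {Ω : Type*} {m : MeasurableSpace Ω} {μ : Measure Ω} {E : Type*} [AddCommGroup E]
  {K : Type*} [RCLike K] [Module (L0 μ K) E] {N : E → L0 μ ℝ} {B : Set E}

/-- No restriction of `x` to a non-null part of `D` belongs to `B`. -/
def Avoids (μ : Measure Ω) (K : Type*) [RCLike K] [Module (L0 μ K) E] (B : Set E) (D : Set Ω)
    (x : E) : Prop :=
  ∀ (A : Set Ω) (hA : MeasurableSet A), A ⊆ D → L0ind μ K A hA • x ∈ B → μ A = 0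

/-- Restricted to `G`, some ball about `0` is contained in `B`. -/
def AbsorbsBallOn (K : Type*) [RCLike K] [Module (L0 μ K) E] (N : E → L0 μ ℝ) (B : Set E)
    (G : Set Ω) : Prop :=
  ∃ hG : MeasurableSet G, ∃ r ∈ L0pp μ, ∀ z, N z ≤ r → L0ind μ K G hG • z ∈ B

theorem ae_mem_of_ae_of_ae_off {A : ℕ → Set Ω} {P : Ω → Prop}
    (h1 : ∀ n, ∀ᵐ ω ∂μ, ω ∈ A n → P ω) (h2 : ∀ᵐ ω ∂μ, ω ∉ (⋃ n, A n) → P ω) :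
    ∀ᵐ ω ∂μ, P ω := by
  filter_upwards [ae_all_iff.2 h1, h2] with ω g1 g2
  by_cases hω : ω ∈ ⋃ n, A n
  · obtain ⟨n, hn⟩ := Set.mem_iUnion.1 hω
    exact g1 n hn
  · exact g2 hω

theorem AbsorbsBallOn.mono (hB : IsL0Balanced μ K B) {G G' : Set Ω}
    (h : AbsorbsBallOn K N B G) (hG' : MeasurableSet G') (hsub : G' ⊆ G) :
    AbsorbsBallOn K N B G' := by
  obtain ⟨hG, r, hr, h⟩ := h
  refine ⟨hG', r, hr, fun z hz => ?_⟩
  rw [← L0ind_smul_smul_of_subset hG' hG hsub]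
  exact hB.ind_smul hG' (h z hz)

/-- The radii are concatenated along the `G n`, and the concatenation property of `B` glues the
pieces `1_{G n} z`, with `0` off the union, to a member of `B`. This is what makes a maximal event
available. -/
theorem AbsorbsBallOn.iUnion (hN : IsL0Norm K N) (h0 : (0 : E) ∈ B)
    (hcc : HasCountableConcat μ K B) {G : ℕ → Set Ω} (hG : ∀ n, AbsorbsBallOn K N B (G n))
    (hd : Pairwise (Function.onFun Disjoint G)) : AbsorbsBallOn K N B (⋃ n, G n) := by
  choose hGm r hr h using hG
  obtain ⟨ε₁, hε₁, -⟩ := exists_L0pp_eq (μ := μ) (f := fun _ => (1 : ℝ)) measurable_const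
    (ae_of_all _ fun _ => one_pos)
  obtain ⟨s, hs, hs1, -⟩ := exists_L0pp_concat hGm hd hr hε₁
  refine ⟨MeasurableSet.iUnion hGm, s, hs, fun z hz => ?_⟩
  have hmem : ∀ n, L0ind μ K (G n) (hGm n) • z ∈ B := by
    intro n
    -- The ball condition is applied to `1_{G n} z` instead of `z`, because `s` agrees with `r n` on
    -- `G n` only.
    rw [← L0ind_smul_smul_of_subset (hGm n) (hGm n) subset_rfl]
    refine h n _ ?_
    rw [L0_le_iff] at hz ⊢
    filter_upwards [hz, hs1 n, hN.coe_ind_smul (hGm n) z,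
      show ∀ᵐ ω ∂μ, 0 < r n ω from hr n] with ω g1 g2 g3 g4
    rw [g3]
    by_cases hω : ω ∈ G n
    · simpa [hω, ← g2 hω] using g1
    · simpa [hω] using g4.le
  obtain ⟨b, hb, hb1, hb2⟩ := hcc.exists_concat hGm hd hmem h0
  convert hb using 1
  refine hN.ext (ae_mem_of_ae_of_ae_off (A := G) (fun n => ?_) ?_)
  · have e : L0ind μ K (G n) (hGm n) • (L0ind μ K (⋃ n, G n) (MeasurableSet.iUnion hGm) • z - b) =
        L0ind μ K (G n) (hGm n) • 0 := by
      rw [smul_sub, hb1 n, L0ind_smul_smul_of_subset _ _ (Set.subset_iUnion G n),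
        L0ind_smul_smul_of_subset _ _ subset_rfl, sub_self, smul_zero]
    filter_upwards [hN.coe_eq_of_ind_smul_eq (hGm n) e, hN.coe_zero] with ω g1 g2 hω
    rw [g1 hω, g2]
  · have e : L0ind μ K (⋃ n, G n)ᶜ (MeasurableSet.iUnion hGm).compl •
        (L0ind μ K (⋃ n, G n) (MeasurableSet.iUnion hGm) • z - b) =
        L0ind μ K (⋃ n, G n)ᶜ (MeasurableSet.iUnion hGm).compl • 0 := by
      rw [smul_sub, hb2, smul_smul, L0ind_mul _ _ MeasurableSet.empty (Set.compl_inter_self _),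
        smul_zero, sub_zero]
      refine hN.ext ?_
      filter_upwards [hN.coe_ind_smul (A := ∅) MeasurableSet.empty z] with ω g
      rw [sub_zero, g]; simp
    filter_upwards [hN.coe_eq_of_ind_smul_eq _ e, hN.coe_zero] with ω g1 g2 hω
    rw [g1 hω, g2]

/-- Members of `B` that approximate `y` on disjoint events can be combined. -/
theorem exists_mem_approx_iUnion (hN : IsL0Norm K N) (h0 : (0 : E) ∈ B)
    (hcc : HasCountableConcat μ K B) {F : ℕ → Set Ω} (hF : ∀ n, MeasurableSet (F n))
    (hd : Pairwise (Function.onFun Disjoint F)) (y : E) (ε : L0 μ ℝ)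
    (h : ∀ n, ∃ b ∈ B, ∀ᵐ ω ∂μ, ω ∈ F n → N (b - y) ω ≤ ε ω) :
    ∃ b ∈ B, ∀ᵐ ω ∂μ, ω ∈ (⋃ n, F n) → N (b - y) ω ≤ ε ω := by
  choose b hb hb' using h
  obtain ⟨c, hc, hc1, -⟩ := hcc.exists_concat hF hd hb h0
  refine ⟨c, hc, ae_mem_of_ae_of_ae_off (A := F) (fun n => ?_)
    (ae_of_all _ fun ω h1 h2 => absurd h2 h1)⟩
  filter_upwards [hb' n, hN.coe_sub_eq_of_ind_smul_eq (hF n) (hc1 n) y] with ω g1 g2 hω _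
  rw [g2 hω]; exact g1 hω

theorem Avoids.mono {D D' : Set Ω} {x : E} (h : Avoids μ K B D x) (hs : D' ⊆ D) :
    Avoids μ K B D' x := fun A hA hAD => h A hA (hAD.trans hs)

/-- If all balls about the points `y'` of some ball approximate `B` after scaling with `c`, on each
non-null part of `C`, then the scaled ball is contained in `B` on `C`. -/
theorem ind_smul_mem_of_not_avoids [IsFiniteMeasure μ] (hN : IsL0Norm K N)
    (hB : IsL0Barrel μ K (Tc N) B) (hcc : HasCountableConcat μ K B) {C : Set Ω}
    (hC : MeasurableSet C) {c : L0 μ K} (hc : L0abs c ≤ 1) {y : E} {r : L0 μ ℝ} (hr : r ∈ L0pp μ)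
    (h : ∀ ε ∈ L0pp μ, ε ≤ r → ∀ H : Set Ω, MeasurableSet H → H ⊆ C → μ H ≠ 0 →
      ∃ z, N (z - y) ≤ ε ∧ ¬ Avoids μ K B H (c • z)) :
    L0ind μ K C hC • c • y ∈ B := by
  let := Tc N
  have h0 : (0 : E) ∈ B := hB.balanced.zero_mem hB.absorbent.nonempty
  rw [← hB.closed.closure_eq, mem_closure_iff_nhds]
  intro U hU
  obtain ⟨ε', hε', hU⟩ := hN.mem_nhds_Tc.1 hU
  obtain ⟨ε, hε, hεe⟩ := exists_L0pp_min hε' hr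
  have hεr : ε ≤ r := by
    rw [L0_le_iff]
    filter_upwards [hεe] with ω h
    rw [h]; exact min_le_right _ _
  -- `F` is an essentially largest part of `C` on which some member of `B` is within `ε` of `c y`.
  obtain ⟨F, ⟨hF, hFC, b, hb, hbF⟩, hmax⟩ := exists_exhausting (μ := μ)
    (fun F => MeasurableSet F ∧ F ⊆ C ∧ ∃ b ∈ B, ∀ᵐ ω ∂μ, ω ∈ F → N (b - c • y) ω ≤ ε ω)
    ⟨MeasurableSet.empty, Set.empty_subset _, 0, h0, ae_of_all _ fun _ h => h.elim⟩
    (fun A h => h.1)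
    (fun A A' ⟨hA, hAC, b, hb, h⟩ hA' hs => ⟨hA', hs.trans hAC, b, hb,
      h.mono fun ω h1 h2 => h1 (hs h2)⟩)
    (fun A hA hd => ⟨MeasurableSet.iUnion fun n => (hA n).1, Set.iUnion_subset fun n => (hA n).2.1,
      exists_mem_approx_iUnion hN h0 hcc (fun n => (hA n).1) hd _ _ fun n => (hA n).2.2⟩)
  -- A non-null rest would contain a non-null `A` with `1_A c z ∈ B` and `N (z - y) ≤ ε`. As `|c| ≤
  -- 1`, this member approximates `c y` on `A`, against the maximality of `F`.
  have hnull : μ (C \ F) = 0 := by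
    by_contra hne
    obtain ⟨z, hz, hzA⟩ := h ε hε hεr (C \ F) (hC.diff hF) Set.sdiff_subset hne
    simp only [Avoids, not_forall] at hzA
    obtain ⟨A, hA, hAC, hAB, hA0⟩ := hzA
    refine hA0 (hmax A ⟨hA, hAC.trans Set.sdiff_subset, _, hAB, ?_⟩
      (Set.disjoint_left.2 fun ω h1 h2 => (hAC h2).2 h1))
    have e : L0ind μ K A hA • (L0ind μ K A hA • c • z) = L0ind μ K A hA • c • z :=
      L0ind_smul_smul_of_subset hA hA subset_rfl _
    rw [L0_le_iff] at hz hc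
    have e2 := hN.coe_smul c (z - y)
    rw [smul_sub] at e2
    filter_upwards [hN.coe_sub_eq_of_ind_smul_eq hA e (c • y), hz, hc, e2, coe_L0abs c,
      coe_L0_one (μ := μ) (R := ℝ), hN.coe_nonneg (z - y)] with ω g1 g2 g3 g4 g5 g6 g7 hω
    rw [g5, g6] at g3
    rw [g1 hω, g4]
    exact (mul_le_of_le_one_left g7 g3).trans g2
  refine ⟨L0ind μ K F hF • b, hU _ ?_, hB.balanced.ind_smul hF hb⟩
  have hae : ∀ᵐ ω ∂μ, ω ∈ C → ω ∈ F := by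
    have : ∀ᵐ ω ∂μ, ω ∉ C \ F := measure_eq_zero_iff_ae_notMem.1 hnull
    filter_upwards [this] with ω h h1
    by_contra h2
    exact h ⟨h1, h2⟩
  have e1 : L0ind μ K F hF • (L0ind μ K F hF • b - L0ind μ K C hC • c • y) =
      L0ind μ K F hF • (b - c • y) := by
    rw [smul_sub, L0ind_smul_smul_of_subset hF hF subset_rfl, L0ind_smul_smul_of_subset hF hC hFC,
      smul_sub]
  rw [L0_le_iff]
  filter_upwards [hae, hN.coe_eq_of_ind_smul_eq hF e1, hbF, hεe,
    show ∀ᵐ ω ∂μ, 0 < ε' ω from hε', hN.coe_sub_le (L0ind μ K F hF • b) 0 (L0ind μ K C hC • c • y),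
    hN.coe_sub_comm 0 (L0ind μ K C hC • c • y), hN.coe_ind_smul hF b,
    hN.coe_ind_smul hC (c • y)] with ω g1 g2 g3 g4 g5 g6 g7 g8 g9
  by_cases hω : ω ∈ F
  · rw [g2 hω]
    exact (g3 hω).trans (g4.trans_le (min_le_left _ _))
  · have hωC : ω ∉ C := fun h => hω (g1 h)
    rw [sub_zero] at g6 g7
    rw [g7, g8, g9, Set.indicator_of_notMem hω, Set.indicator_of_notMem hωC, add_zero] at g6
    exact g6.trans g5.le

theorem coe_L0_const {K : Type*} [RCLike K] (a : K) :
    ∀ᵐ ω ∂μ, (AEEqFun.const Ω a : L0 μ K) ω = a := AEEqFun.coeFn_const _ _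

/-- A ball about an arbitrary point that is contained in a multiple of `B` on `C` can be moved
to `0`. -/
theorem absorbsBallOn_of_forall (hN : IsL0Norm K N)
    (hB : IsL0Balanced μ K B) (hconv : IsL0Convex μ K B) {C : Set Ω} (hC : MeasurableSet C) {t : ℝ}
    (ht : 0 < t) {y : E} {r : L0 μ ℝ} (hr : r ∈ L0pp μ)
    (h : ∀ y', N (y' - y) ≤ r → L0ind μ K C hC • (AEEqFun.const Ω (t : K) : L0 μ K) • y' ∈ B) :
    AbsorbsBallOn K N B C := by
  have hr' : ∀ᵐ ω ∂μ, 0 < r ω := hr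
  -- The identity behind the radius is `1_C z = ½ · 1_C t (y + (2/t) z) + ½ · (-1_C t y)`: the point
  -- `y + (2/t) z` has to stay within `r` of `y`.
  obtain ⟨s, hs, hse⟩ := exists_L0pp_eq (μ := μ) (f := fun ω => t / 2 * r ω)
    (measurable_const.mul (AEEqFun.measurable r)) (by
      filter_upwards [hr'] with ω h; positivity)
  refine ⟨hC, s, hs, fun z hz => ?_⟩
  let d : L0 μ K := AEEqFun.const Ω ((2 / t : ℝ) : K)
  let q : L0 μ ℝ := AEEqFun.const Ω (1 / 2 : ℝ)
  have h1 := h (y + d • z) (by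
    rw [add_sub_cancel_left, L0_le_iff]
    rw [L0_le_iff] at hz
    filter_upwards [hz, hN.coe_smul d z, hse, coe_L0_const (μ := μ) ((2 / t : ℝ) : K)]
      with ω g1 g2 g3 g4
    rw [g2, g4, RCLike.norm_ofReal, abs_of_pos (by positivity)]
    calc 2 / t * N z ω ≤ 2 / t * (t / 2 * r ω) := by rw [g3] at g1; gcongr
      _ = r ω := by field_simp)
  have h2 := hB.neg_mem (h y (by
    rw [L0_le_iff]
    filter_upwards [hN.coe_sub_self y, hr'] with ω g1 g2
    rw [g1]; exact g2.le))
  have h3 := hconv _ h1 _ h2 q (by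
    rw [L0_le_iff]
    filter_upwards [coe_L0_const (μ := μ) (1 / 2 : ℝ), coe_L0_zero (μ := μ) (R := ℝ)] with ω g1 g2
    rw [g1, g2]; norm_num) (by
    rw [L0_le_iff]
    filter_upwards [coe_L0_const (μ := μ) (1 / 2 : ℝ), coe_L0_one (μ := μ) (R := ℝ)] with ω g1 g2
    rw [g1, g2]; norm_num)
  convert h3 using 1
  have e1 : L0ofReal K q + L0ofReal K q = 1 := by
    refine L0_ext ?_
    filter_upwards [coe_L0_add (L0ofReal K q) (L0ofReal K q), coe_L0ofReal (K := K) q,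
      coe_L0_const (μ := μ) (1 / 2 : ℝ), coe_L0_one (μ := μ) (R := K)] with ω g1 g2 g3 g4
    rw [g1, g2, g3, g4, ← RCLike.ofReal_add]
    norm_num
  have e2 : L0ofReal K q * (AEEqFun.const Ω (t : K) : L0 μ K) * d = 1 := by
    refine L0_ext ?_
    filter_upwards [coe_L0_mul (L0ofReal K q * (AEEqFun.const Ω (t : K) : L0 μ K)) d,
      coe_L0_mul (L0ofReal K q) (AEEqFun.const Ω (t : K) : L0 μ K), coe_L0ofReal (K := K) q,
      coe_L0_const (μ := μ) (1 / 2 : ℝ), coe_L0_one (μ := μ) (R := K),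
      coe_L0_const (μ := μ) (t : K), coe_L0_const (μ := μ) ((2 / t : ℝ) : K)]
      with ω g1 g2 g3 g4 g5 g6 g7
    rw [g1, g2, g3, g4, g5, g6, g7, ← RCLike.ofReal_mul, ← RCLike.ofReal_mul,
      show 1 / 2 * t * (2 / t) = 1 by field_simp, RCLike.ofReal_one]
  generalize (AEEqFun.const Ω (t : K) : L0 μ K) = a at *
  generalize L0ofReal K q = b at *
  generalize L0ind μ K C hC = i at *
  linear_combination (norm := module) (-e2) • (i • z) - e1 • (i • a • y)

end Barrel

/-! ### The nested balls argument. -/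

section PreBarreled

variable {Ω : Type*} {m : MeasurableSpace Ω} {μ : Measure Ω} {E : Type*} [AddCommGroup E]
  {K : Type*} [RCLike K] [Module (L0 μ K) E] {N : E → L0 μ ℝ} {B : Set E}

/-- The extension step of the nested balls argument, on a union of disjoint events. -/
theorem exists_ball_avoids_iUnion (hN : IsL0Norm K N) (hB : IsL0Balanced μ K B)
    (hcc : HasCountableConcat μ K (Set.univ : Set E)) {A : ℕ → Set Ω}
    (hA : ∀ n, MeasurableSet (A n)) (hd : Pairwise (Function.onFun Disjoint A)) (c : L0 μ K)
    (y : E) {r : L0 μ ℝ} (hr : r ∈ L0pp μ)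
    (h : ∀ n, ∃ y' : E, ∃ r' ∈ L0pp μ, N (y' - y) ≤ r ∧ r' ≤ r ∧
      ∀ z, N (z - y') ≤ r' → Avoids μ K B (A n) (c • z)) :
    ∃ y' : E, ∃ r' ∈ L0pp μ, N (y' - y) ≤ r ∧ r' ≤ r ∧
      ∀ z, N (z - y') ≤ r' → Avoids μ K B (⋃ n, A n) (c • z) := by
  choose y' r' hr' hyy hrr hav using h
  obtain ⟨w, -, hw1, hw2⟩ := hcc.exists_concat hA hd (x := y') (fun _ => trivial) (z := y) trivial
  obtain ⟨s, hs, hs1, hs2⟩ := exists_L0pp_concat hA hd hr' hr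
  refine ⟨w, s, hs, ?_, ?_, fun z hz D hD hDA hDB => ?_⟩
  · rw [L0_le_iff]
    refine ae_mem_of_ae_of_ae_off (A := A) (fun n => ?_) ?_
    · filter_upwards [L0_le_iff.1 (hyy n), hN.coe_sub_eq_of_ind_smul_eq (hA n) (hw1 n) y]
        with ω g1 g2 hω
      rw [g2 hω]; exact g1
    · filter_upwards [hN.coe_sub_eq_of_ind_smul_eq _ hw2 y, hN.coe_sub_self y,
        show ∀ᵐ ω ∂μ, 0 < r ω from hr] with ω g1 g2 g3 hω
      rw [g1 hω, g2]; exact g3.le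
  · rw [L0_le_iff]
    refine ae_mem_of_ae_of_ae_off (A := A) (fun n => ?_) ?_
    · filter_upwards [L0_le_iff.1 (hrr n), hs1 n] with ω g1 g2 hω
      rw [g2 hω]; exact g1
    · filter_upwards [hs2] with ω g1 hω
      exact (g1 hω).le
  · have hpart : ∀ n, μ (D ∩ A n) = 0 := by
      intro n
      have e0 : L0ind μ K (A n) (hA n) • (y' n + L0ind μ K (A n) (hA n) • (z - y' n)) =
          L0ind μ K (A n) (hA n) • z := by
        rw [smul_add, L0ind_smul_smul_of_subset _ _ subset_rfl, ← smul_add, add_sub_cancel]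
      -- Off `A n` the point `z` may be far from `y' n`. The test point agrees with `z` on `A n` and
      -- with `y' n` elsewhere, so it lies in the ball about `y' n`.
      refine hav n (y' n + L0ind μ K (A n) (hA n) • (z - y' n)) ?_ (D ∩ A n) (hD.inter (hA n))
        Set.inter_subset_right ?_
      · rw [add_sub_cancel_left, L0_le_iff]
        rw [L0_le_iff] at hz
        have e1 : L0ind μ K (A n) (hA n) • (z - y' n) = L0ind μ K (A n) (hA n) • (z - w) := by
          rw [smul_sub, smul_sub, hw1 n]
        rw [e1]
        filter_upwards [hz, hN.coe_ind_smul (hA n) (z - w), hs1 n,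
          show ∀ᵐ ω ∂μ, 0 < r' n ω from hr' n] with ω g1 g2 g3 g4
        rw [g2]
        by_cases hω : ω ∈ A n
        · rw [Set.indicator_of_mem hω, ← g3 hω]; exact g1
        · rw [Set.indicator_of_notMem hω]; exact g4.le
      · rw [← L0ind_smul_smul_of_subset (hD.inter (hA n)) (hA n) Set.inter_subset_right,
          smul_comm _ c, e0, smul_comm c,
          L0ind_smul_smul_of_subset (hD.inter (hA n)) (hA n) Set.inter_subset_right,
          ← L0ind_smul_smul_of_subset (hD.inter (hA n)) hD Set.inter_subset_left]
        exact hB.ind_smul _ hDB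
    have : D = ⋃ n, D ∩ A n := by
      rw [← Set.inter_iUnion, Set.inter_eq_left.2 hDA]
    rw [this, measure_iUnion_null_iff]
    exact hpart

/-- If no ball is contained in `B` on a non-null part of `D`, then every ball contains a ball
that avoids a given multiple of `B` on `D`. -/
theorem exists_ball_avoids [IsFiniteMeasure μ] (hN : IsL0Norm K N)
    (hE : HasCountableConcat μ K (Set.univ : Set E))
    (hB : IsL0Barrel μ K (Tc N) B) (hcc : HasCountableConcat μ K B) {D : Set Ω}
    (hD : MeasurableSet D) (hbad : ∀ G ⊆ D, AbsorbsBallOn K N B G → μ G = 0) {t : ℝ}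
    (ht0 : 0 < t) (ht1 : t ≤ 1) (y : E) {r : L0 μ ℝ} (hr : r ∈ L0pp μ) :
    ∃ y' : E, ∃ r' ∈ L0pp μ, N (y' - y) ≤ r ∧ r' ≤ r ∧
      ∀ z, N (z - y') ≤ r' → Avoids μ K B D ((AEEqFun.const Ω (t : K) : L0 μ K) • z) := by
  -- `A` is an essentially largest part of `D` on which an avoiding ball exists; the empty event
  -- qualifies with the given ball itself.
  obtain ⟨A, ⟨hA, hAD, y', r', hr', hyy, hrr, hav⟩, hmax⟩ := exists_exhausting (μ := μ)
    (fun A => MeasurableSet A ∧ A ⊆ D ∧ ∃ y' : E, ∃ r' ∈ L0pp μ, N (y' - y) ≤ r ∧ r' ≤ r ∧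
      ∀ z, N (z - y') ≤ r' → Avoids μ K B A ((AEEqFun.const Ω (t : K) : L0 μ K) • z))
    ⟨MeasurableSet.empty, Set.empty_subset _, y, r, hr, by
      rw [L0_le_iff]
      filter_upwards [hN.coe_sub_self y, show ∀ᵐ ω ∂μ, 0 < r ω from hr] with ω g1 g2
      rw [g1]; exact g2.le, le_rfl, fun z _ A _ hA _ => by
        rw [Set.subset_empty_iff.1 hA, measure_empty]⟩
    (fun A h => h.1)
    (fun A A' ⟨_, hAD, y', r', hr', h1, h2, h3⟩ hA' hs => ⟨hA', hs.trans hAD, y', r', hr', h1, h2,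
      fun z hz => (h3 z hz).mono hs⟩)
    (fun A hA hd => ⟨MeasurableSet.iUnion fun n => (hA n).1, Set.iUnion_subset fun n => (hA n).2.1,
      exists_ball_avoids_iUnion hN hB.balanced hE (fun n => (hA n).1) hd _ y hr
        fun n => (hA n).2.2⟩)
  refine ⟨y', r', hr', hyy, hrr, fun z hz F hF hFD hFB => ?_⟩
  have hc : L0abs (AEEqFun.const Ω (t : K) : L0 μ K) ≤ 1 := by
    rw [L0_le_iff]
    filter_upwards [coe_L0abs (AEEqFun.const Ω (t : K) : L0 μ K), coe_L0_const (μ := μ) (t : K),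
      coe_L0_one (μ := μ) (R := ℝ)] with ω g1 g2 g3
    rw [g1, g2, g3, RCLike.norm_ofReal, abs_of_pos ht0]
    exact ht1
  -- By maximality, no small ball about a point `x` of the given ball avoids `B` on a non-null part
  -- of `D \ A`. Hence `B` contains `1_{D \ A} t x` for all such `x`, so it absorbs a ball on `D \
  -- A`, and `hbad` applies.
  have hC : μ (D \ A) = 0 := by
    refine hbad _ Set.sdiff_subset (absorbsBallOn_of_forall hN hB.balanced hB.convex
      (hD.diff hA) ht0 (y := y) hr fun x hx => ?_)
    refine ind_smul_mem_of_not_avoids hN hB hcc (hD.diff hA) hc hr fun ε hε hεr H hH hHC hH0 => ?_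
    by_contra! hcon
    exact hH0 (hmax H ⟨hH, hHC.trans Set.sdiff_subset, x, ε, hε, hx, hεr, hcon⟩
      (Set.disjoint_left.2 fun ω h1 h2 => (hHC h2).2 h1))
  have hFA : μ (F ∩ A) = 0 := by
    refine hav z hz _ (hF.inter hA) Set.inter_subset_right ?_
    rw [← L0ind_smul_smul_of_subset (hF.inter hA) hF Set.inter_subset_left]
    exact hB.balanced.ind_smul _ hFB
  refine measure_mono_null (fun ω hω => ?_) (measure_union_null hFA hC)
  by_cases h : ω ∈ A
  · exact Or.inl ⟨hω, h⟩
  · exact Or.inr ⟨hFD hω, h⟩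

/-- An absorbent set is not avoided in all its multiples. -/
theorem measure_eq_zero_of_forall_avoids (habs : IsL0Absorbent μ K B)
    {D : Set Ω} (hD : MeasurableSet D) (x : E)
    (h : ∀ n : ℕ, Avoids μ K B D ((AEEqFun.const Ω ((1 / ((n : ℝ) + 1) : ℝ) : K) : L0 μ K) • x)) :
    μ D = 0 := by
  obtain ⟨ξ, hξ, hξx⟩ := habs x
  -- On this event the scalar `1 / (n + 1)` is dominated by `ξ`, so the restricted multiple of `x`
  -- belongs to `B`. These events exhaust `D ∩ {ξ > 0}`.
  have hn : ∀ n : ℕ, μ (D ∩ {ω | 1 / ((n : ℝ) + 1) ≤ ξ ω}) = 0 := by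
    intro n
    have hm : MeasurableSet {ω | 1 / ((n : ℝ) + 1) ≤ ξ ω} :=
      measurableSet_le measurable_const (AEEqFun.measurable ξ)
    refine h n _ (hD.inter hm) Set.inter_subset_left ?_
    rw [smul_smul]
    refine hξx _ ?_ x rfl
    rw [L0_le_iff]
    filter_upwards [coe_L0abs (L0ind μ K _ (hD.inter hm) *
        (AEEqFun.const Ω ((1 / ((n : ℝ) + 1) : ℝ) : K) : L0 μ K)),
      coe_L0_mul (L0ind μ K _ (hD.inter hm)) (AEEqFun.const Ω ((1 / ((n : ℝ) + 1) : ℝ) : K)),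
      coe_L0ind (μ := μ) K (hD.inter hm), coe_L0_const (μ := μ) ((1 / ((n : ℝ) + 1) : ℝ) : K),
      show ∀ᵐ ω ∂μ, 0 < ξ ω from hξ] with ω g1 g2 g3 g4 g5
    rw [g1, g2, g3, g4, norm_mul, RCLike.norm_ofReal, abs_of_pos (by positivity)]
    by_cases hω : ω ∈ D ∩ {ω | 1 / ((n : ℝ) + 1) ≤ ξ ω}
    · rw [Set.indicator_of_mem hω, norm_one, one_mul]; exact hω.2
    · rw [Set.indicator_of_notMem hω, norm_zero, zero_mul]; exact g5.le
  have hpos : μ {ω | ¬ 0 < ξ ω} = 0 := ae_iff.1 hξ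
  refine measure_mono_null (fun ω hω => ?_)
    (measure_union_null (measure_iUnion_null hn) hpos)
  by_cases h0 : 0 < ξ ω
  · obtain ⟨n, hn⟩ := exists_nat_one_div_lt h0
    exact Or.inl (Set.mem_iUnion.2 ⟨n, hω, hn.le⟩)
  · exact Or.inr h0

/-- Nested balls in a geometrically complete module have a common point. -/
theorem GeometricallyComplete.exists_mem_balls (hN : IsL0Norm K N) (hc : GeometricallyComplete N)
    (x : ℕ → E) (r : ℕ → L0 μ ℝ) (hr : ∀ n, r n ∈ L0pp μ) (hr0 : ∀ᵐ ω ∂μ, r 0 ω ≤ 1)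
    (hrs : ∀ n, ∀ᵐ ω ∂μ, r (n + 1) ω ≤ r n ω / 2)
    (hx : ∀ n, ∀ᵐ ω ∂μ, N (x (n + 1) - x n) ω ≤ r n ω / 2) :
    ∃ y, ∀ n, N (y - x n) ≤ r n := by
  have hpos : ∀ᵐ ω ∂μ, ∀ n, 0 < r n ω := ae_all_iff.2 hr
  have hgeo : ∀ᵐ ω ∂μ, ∀ n, r n ω ≤ (1 / 2 : ℝ) ^ n := by
    filter_upwards [hr0, ae_all_iff.2 hrs] with ω g1 g2 n
    induction n with
    | zero => simpa using g1
    | succ n ih => rw [pow_succ]; linarith [g2 n]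
  obtain ⟨y, hy⟩ := hc x fun n => by
    filter_upwards [hx n, hgeo, hpos] with ω g1 g2 g3
    linarith [g2 n, g3 n]
  refine ⟨y, fun n => ?_⟩
  rw [L0_le_iff]
  filter_upwards [ae_all_iff.2 hrs, ae_all_iff.2 hx, hpos, ae_all_iff.2 hy, hN.coe_sub_self (x n),
    ae_all_iff.2 fun k => hN.coe_sub_le (x (k + 1)) (x k) (x n),
    ae_all_iff.2 fun k => hN.coe_sub_le y (x k) (x n)] with ω g1 g2 g3 g4 g5 g6 g7
  -- Each later ball stays inside the `n`-th one: a step of half the radius plus a new radius of at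
  -- most half the old one. This recovers the bound `r n`, sharper than the constant `2 · 2⁻ⁿ` from
  -- completeness.
  have hk : ∀ k, N (x (n + k) - x n) ω + r (n + k) ω ≤ r n ω := by
    intro k
    induction k with
    | zero => rw [add_zero, g5, zero_add]
    | succ k ih =>
      have := g6 (n + k)
      have := g1 (n + k)
      have := g2 (n + k)
      rw [← add_assoc]
      linarith
  have ht : Filter.Tendsto (fun k : ℕ => 2 * (1 / 2 : ℝ) ^ (n + k) + r n ω) Filter.atTop
      (nhds (2 * 0 + r n ω)) := by
    refine Filter.Tendsto.add_const _ (Filter.Tendsto.const_mul _ ?_)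
    have := (tendsto_pow_atTop_nhds_zero_of_lt_one (r := (1 / 2 : ℝ)) (by norm_num)
      (by norm_num))
    exact this.comp (Filter.tendsto_atTop_mono (fun k => Nat.le_add_left k n) Filter.tendsto_id)
  rw [mul_zero, zero_add] at ht
  refine ge_of_tendsto' ht fun k => ?_
  linarith [hk k, g3 (n + k), g4 (n + k), g7 (n + k)]

/-- A barrel with the countable concatenation property in a geometrically complete random normed
module is a neighbourhood of `0`. -/
theorem GeometricallyComplete.barrel_mem_nhds [IsFiniteMeasure μ] (hN : IsL0Norm K N)
    (hc : GeometricallyComplete N) (hE : HasCountableConcat μ K (Set.univ : Set E))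
    (hB : IsL0Barrel μ K (Tc N) B) (hcc : HasCountableConcat μ K B) :
    B ∈ @nhds E (Tc N) 0 := by
  have h0 : (0 : E) ∈ B := hB.balanced.zero_mem hB.absorbent.nonempty
  obtain ⟨ε₁, hε₁, hε₁e⟩ := exists_L0pp_eq (μ := μ) (f := fun _ => (1 : ℝ)) measurable_const
    (ae_of_all _ fun _ => one_pos)
  obtain ⟨G, ⟨hG, r, hr, hGr⟩, hmax⟩ := exists_exhausting (μ := μ) (AbsorbsBallOn K N B)
    ⟨MeasurableSet.empty, ε₁, hε₁, fun z _ => by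
      convert h0 using 1
      refine hN.ext ?_
      filter_upwards [hN.coe_ind_smul (A := ∅) MeasurableSet.empty z] with ω g
      rw [sub_zero, g]; simp⟩
    (fun A h => h.1) (fun A A' h hA' hs => h.mono hB.balanced hA' hs)
    (fun A hA hd => AbsorbsBallOn.iUnion hN h0 hcc hA hd)
  suffices hnull : μ Gᶜ = 0 by
    refine hN.mem_nhds_Tc.2 ⟨r, hr, fun z hz => ?_⟩
    rw [sub_zero] at hz
    convert hGr z hz using 1
    refine hN.ext ?_
    have e : L0ind μ K G hG • (z - L0ind μ K G hG • z) = L0ind μ K G hG • 0 := by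
      rw [smul_sub, L0ind_smul_smul_of_subset _ _ subset_rfl, sub_self, smul_zero]
    filter_upwards [hN.coe_eq_of_ind_smul_eq hG e, hN.coe_zero,
      measure_eq_zero_iff_ae_notMem.1 hnull] with ω g1 g2 g3
    rw [g1 (not_not.1 g3), g2]
  -- The radius is halved before a ball is chosen inside, which gives the halving required by
  -- `exists_mem_balls`.
  have hstep : ∀ (n : ℕ) (y : E) (r : L0 μ ℝ), r ∈ L0pp μ → ∃ y' : E, ∃ r' ∈ L0pp μ,
      (∀ᵐ ω ∂μ, N (y' - y) ω ≤ r ω / 2) ∧ (∀ᵐ ω ∂μ, r' ω ≤ r ω / 2) ∧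
      ∀ z, N (z - y') ≤ r' → Avoids μ K B Gᶜ
        ((AEEqFun.const Ω ((1 / ((n : ℝ) + 1) : ℝ) : K) : L0 μ K) • z) := by
    intro n y r hr
    obtain ⟨s, hs, hse⟩ := exists_L0pp_half hr
    obtain ⟨y', r', hr', h1, h2, h3⟩ := exists_ball_avoids hN hE hB hcc hG.compl
      (fun A hA h => hmax A h (Set.disjoint_left.2 fun ω h1 h2 => hA h2 h1))
      (t := 1 / ((n : ℝ) + 1)) (by positivity)
      (by rw [div_le_one (by positivity)]; linarith [n.cast_nonneg (α := ℝ)]) y hs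
    refine ⟨y', r', hr', ?_, ?_, h3⟩
    · filter_upwards [L0_le_iff.1 h1, hse] with ω g1 g2 using g1.trans_eq g2
    · filter_upwards [L0_le_iff.1 h2, hse] with ω g1 g2 using g1.trans_eq g2
  choose Y R hR hYd hRd hav using hstep
  let u : ℕ → E × {r : L0 μ ℝ // r ∈ L0pp μ} := fun n => Nat.rec (0, ⟨ε₁, hε₁⟩)
    (fun n v => (Y n v.1 v.2.1 v.2.2, ⟨R n v.1 v.2.1 v.2.2, hR n v.1 v.2.1 v.2.2⟩)) n
  obtain ⟨x, hx⟩ := hc.exists_mem_balls hN (fun n => (u n).1) (fun n => (u n).2.1)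
    (fun n => (u n).2.2) (hε₁e.mono fun ω h => h.le)
    (fun n => hRd n (u n).1 (u n).2.1 (u n).2.2) (fun n => hYd n (u n).1 (u n).2.1 (u n).2.2)
  exact measure_eq_zero_of_forall_avoids hB.absorbent hG.compl x
    -- Ball `n + 1` is the one chosen for the factor `1 / (n + 1)`; ball `0`, of radius `1` about
    -- `0`, only starts the recursion.
    fun n => hav n (u n).1 (u n).2.1 (u n).2.2 x (hx (n + 1))

theorem GeometricallyComplete.isL0PreBarreled [IsFiniteMeasure μ] (hN : IsL0Norm K N)
    (hc : GeometricallyComplete N) (hE : HasCountableConcat μ K (Set.univ : Set E)) :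
    IsL0PreBarreled μ K (Tc N) where
  locallyConvex := hN.isLocallyL0ConvexModule_Tc
  barrel_mem_nhds _ hB hcc := hc.barrel_mem_nhds hN hE hB hcc

end PreBarreled

/-! ### Measurability over a single σ-algebra, for use with the sub-σ-algebra. -/

section MeasurableENN

open scoped ENNReal

variable {Ω : Type*} {m : MeasurableSpace Ω} {μ : Measure Ω}

theorem measurable_add_ENN {f g : Ω → ℝ≥0∞} (hf : Measurable f) (hg : Measurable g) :
    Measurable fun ω => f ω + g ω := hf.add hg

theorem measurableSet_le_ENN {f g : Ω → ℝ≥0∞} (hf : Measurable f) (hg : Measurable g) :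
    MeasurableSet {ω | f ω ≤ g ω} := measurableSet_le hf hg

open Classical in
theorem measurable_weight_ENN {a b c : Ω → ℝ≥0∞} (ha : Measurable a) (hb : Measurable b)
    (hc : Measurable c) (q : ℝ) : Measurable fun ω => if a ω + b ω = ∞ then ∞ else
      (a ω + b ω) ^ q * (c ω / (a ω + b ω)) * (c ω)⁻¹ ^ q := by
  have hs : Measurable fun ω => a ω + b ω := ha.add hb
  exact Measurable.ite (hs (measurableSet_singleton ∞)) measurable_const
    (((hs.pow_const q).mul (hc.div hs)).mul (hc.inv.pow_const q))

theorem measurableSet_L0_ne_zero (ξ : L0 μ ℝ) : MeasurableSet {ω | ξ ω ≠ 0} :=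
  (AEEqFun.measurable ξ) (measurableSet_singleton 0).compl

theorem measurable_L0_inv (ξ : L0 μ ℝ) : Measurable fun ω => (ξ ω)⁻¹ :=
  (AEEqFun.measurable ξ).inv

end MeasurableENN

/-! ### The conditional norm: triangle inequality, homogeneity, locality. -/

section CondNorm

open scoped ENNReal

variable {Ω : Type*} {m m0 : MeasurableSpace Ω} {μ : Measure[m0] Ω}

theorem ae_le_trim_iff_ENN (hm : m ≤ m0) {f g : Ω → ℝ≥0∞} (hf : Measurable[m] f)
    (hg : Measurable[m] g) : (∀ᵐ ω ∂(μ.trim hm), f ω ≤ g ω) ↔ ∀ᵐ ω ∂μ, f ω ≤ g ω := by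
  refine ⟨ae_of_ae_trim hm, fun h => ?_⟩
  rw [ae_iff] at h ⊢
  exact (trim_measurableSet_eq hm (measurableSet_le_ENN hf hg).compl).trans h

theorem aemeasurable_enorm_rpow (x : L0 μ ℝ) (q : ℝ) : AEMeasurable (fun ω => ‖x ω‖ₑ ^ q) μ :=
  ((AEEqFun.aestronglyMeasurable x).enorm).pow_const _

variable [IsFiniteMeasure μ]

/-- The infimum of the majorants is itself a majorant, so bounds on it amount to pointwise bounds on
`|x|`. The norm estimates for `p = ∞` reduce to this. -/
theorem eCondNorm_top_le_iff (hm : m ≤ m0) (x : L0 μ ℝ) {f : Ω → ℝ≥0∞} (hf : Measurable[m] f) :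
    (∀ᵐ ω ∂(μ.trim hm), L0rep (eCondNorm hm ∞ x) ω ≤ f ω) ↔ ∀ᵐ ω ∂μ, ‖x ω‖ₑ ≤ f ω := by
  have hG := (exists_isGLB_condMajorants hm x).choose_spec
  obtain ⟨ζ, hζ⟩ := exists_isLeast_condMajorants hm x
  have he : eCondNorm hm ∞ x = ζ := by
    rw [eCondNorm, if_pos rfl]; exact hG.unique hζ.isGLB
  rw [he]
  constructor
  · intro h
    filter_upwards [hζ.1, ae_of_ae_trim hm h] with ω h1 h2 using h1.trans h2
  · intro h
    have h1 := L0rep_L0mkENN (μ := μ.trim hm) f hf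
    have h2 : ζ ≤ L0mkENN (μ.trim hm) f hf := hζ.2 (by
      filter_upwards [h, ae_of_ae_trim hm h1] with ω g1 g2
      rw [g2]; exact g1)
    filter_upwards [L0rep_le h2, h1] with ω g1 g2
    exact g1.trans_eq g2

theorem L0rep_eCondNorm (hm : m ≤ m0) {p : ℝ≥0∞} (hp : p ≠ ∞) (x : L0 μ ℝ) :
    ∀ᵐ ω ∂(μ.trim hm), L0rep (eCondNorm hm p x) ω =
      (condLExp m μ (fun ω => ‖x ω‖ₑ ^ p.toReal) ω) ^ (1 / p.toReal) := by
  rw [eCondNorm, if_neg hp]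
  exact L0rep_L0rpow _ _ _

theorem eCondNorm_le_iff (hm : m ≤ m0) {p : ℝ≥0∞} (hp1 : 1 ≤ p) (hp : p ≠ ∞) (x : L0 μ ℝ)
    {f : Ω → ℝ≥0∞} (hf : Measurable[m] f) :
    (∀ᵐ ω ∂(μ.trim hm), L0rep (eCondNorm hm p x) ω ≤ f ω) ↔
      ∀ᵐ ω ∂μ, condLExp m μ (fun ω => ‖x ω‖ₑ ^ p.toReal) ω ≤ f ω ^ p.toReal := by
  have hq : 0 < p.toReal := ENNReal.toReal_pos (zero_lt_one.trans_le hp1).ne' hp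
  rw [← ae_le_trim_iff_ENN hm (measurable_condLExp m μ _) (measurable_rpow_ENN hf _)]
  constructor <;> intro h <;> filter_upwards [h, L0rep_eCondNorm hm hp x] with ω h1 h2
  · rw [h2] at h1
    rwa [one_div, ENNReal.rpow_inv_le_iff hq] at h1
  · rwa [h2, one_div, ENNReal.rpow_inv_le_iff hq]

theorem condLExp_eq_eCondNorm_rpow (hm : m ≤ m0) {p : ℝ≥0∞} (hp1 : 1 ≤ p) (hp : p ≠ ∞)
    (x : L0 μ ℝ) : ∀ᵐ ω ∂μ, condLExp m μ (fun ω => ‖x ω‖ₑ ^ p.toReal) ω =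
      L0rep (eCondNorm hm p x) ω ^ p.toReal := by
  have hq : p.toReal ≠ 0 := (ENNReal.toReal_pos (zero_lt_one.trans_le hp1).ne' hp).ne'
  filter_upwards [ae_of_ae_trim hm (L0rep_eCondNorm hm hp x)] with ω h
  rw [h, ← ENNReal.rpow_mul, one_div_mul_cancel hq, ENNReal.rpow_one]

/-- Weighted form of the convexity of the power function. -/
theorem ENN_add_rpow_le {q : ℝ} (hq : 1 ≤ q) {a b : ℝ≥0∞} (ha : a ≠ 0) (ha' : a ≠ ∞) (hb : b ≠ 0)
    (hb' : b ≠ ∞) (X Y : ℝ≥0∞) :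
    (X + Y) ^ q ≤ (a + b) ^ q * (a / (a + b)) * a⁻¹ ^ q * X ^ q +
      (a + b) ^ q * (b / (a + b)) * b⁻¹ ^ q * Y ^ q := by
  have hq0 : 0 ≤ q := zero_le_one.trans hq
  have hab : a + b ≠ 0 := by simp [ha]
  have hab' : a + b ≠ ∞ := ENNReal.add_ne_top.2 ⟨ha', hb'⟩
  have hw : a / (a + b) + b / (a + b) = 1 := by
    rw [← ENNReal.add_div, ENNReal.div_self hab hab']
  have h := ENNReal.rpow_arith_mean_le_arith_mean2_rpow (a / (a + b)) (b / (a + b))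
    (a⁻¹ * X) (b⁻¹ * Y) hw hq
  -- The sum is `a + b` times a convex combination of `X / a` and `Y / b`, to which convexity of the
  -- power is applied.
  have e : X + Y = (a + b) * (a / (a + b) * (a⁻¹ * X) + b / (a + b) * (b⁻¹ * Y)) := by
    have h1 : ∀ c Z : ℝ≥0∞, c ≠ 0 → c ≠ ∞ → (a + b) * (c / (a + b) * (c⁻¹ * Z)) = Z := by
      intro c Z hc hc'
      rw [← mul_assoc, ENNReal.mul_div_cancel hab hab', ← mul_assoc, ENNReal.mul_inv_cancel hc hc',
        one_mul]
    rw [mul_add, h1 a X ha ha', h1 b Y hb hb']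
  rw [e, ENNReal.mul_rpow_of_nonneg _ _ hq0]
  refine (mul_le_mul_right h _).trans_eq ?_
  rw [ENNReal.mul_rpow_of_nonneg _ _ hq0, ENNReal.mul_rpow_of_nonneg _ _ hq0]
  ring

/-- The weighted bound `ENN_add_rpow_le` is sharp at `X = a`, `Y = b`. Hence nothing is lost when
the conditional expectations are replaced by their bounds `a ^ q` and `b ^ q`. -/
theorem ENN_weights_eq {q : ℝ} (hq : 1 ≤ q) {a b : ℝ≥0∞} (ha : a ≠ 0) (ha' : a ≠ ∞) (hb : b ≠ 0)
    (hb' : b ≠ ∞) : (a + b) ^ q * (a / (a + b)) * a⁻¹ ^ q * a ^ q +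
      (a + b) ^ q * (b / (a + b)) * b⁻¹ ^ q * b ^ q = (a + b) ^ q := by
  have hq0 : 0 ≤ q := zero_le_one.trans hq
  have h1 : ∀ c : ℝ≥0∞, c ≠ 0 → c ≠ ∞ → c⁻¹ ^ q * c ^ q = 1 := fun c hc hc' => by
    rw [← ENNReal.mul_rpow_of_nonneg _ _ hq0, ENNReal.inv_mul_cancel hc hc', ENNReal.one_rpow]
  rw [mul_assoc _ (a⁻¹ ^ q), mul_assoc _ (b⁻¹ ^ q), h1 a ha ha', h1 b hb hb', mul_one, mul_one,
    ← mul_add, ← ENNReal.add_div, ENNReal.div_self (by simp [ha])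
    (ENNReal.add_ne_top.2 ⟨ha', hb'⟩), mul_one]

open Classical in
/-- Conditional Minkowski inequality for bounds that are bounded away from `0`. -/
theorem condLExp_add_rpow_le (hm : m ≤ m0) {q : ℝ} (hq : 1 ≤ q) (x y : L0 μ ℝ)
    {a b : Ω → ℝ≥0∞} (ha : Measurable[m] a) (hb : Measurable[m] b) (ha0 : ∀ ω, a ω ≠ 0)
    (hb0 : ∀ ω, b ω ≠ 0)
    (hx : ∀ᵐ ω ∂μ, condLExp m μ (fun ω => ‖x ω‖ₑ ^ q) ω ≤ a ω ^ q)
    (hy : ∀ᵐ ω ∂μ, condLExp m μ (fun ω => ‖y ω‖ₑ ^ q) ω ≤ b ω ^ q) :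
    ∀ᵐ ω ∂μ, condLExp m μ (fun ω => ‖(x + y) ω‖ₑ ^ q) ω ≤ (a ω + b ω) ^ q := by
  have hq0 : 0 < q := zero_lt_one.trans_le hq
  -- The weights are measurable for the sub-σ-algebra, so they can be pulled out of the conditional
  -- expectation. Where `a + b = ∞` the claim is trivial, and the value `∞` keeps the pointwise
  -- majorization valid there.
  let w : (Ω → ℝ≥0∞) → Ω → ℝ≥0∞ := fun c ω =>
    if a ω + b ω = ∞ then ∞ else (a ω + b ω) ^ q * (c ω / (a ω + b ω)) * (c ω)⁻¹ ^ q
  have hw : ∀ c : Ω → ℝ≥0∞, Measurable[m] c → Measurable[m] (w c) := fun c hc =>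
    measurable_weight_ENN ha hb hc q
  have hX := aemeasurable_enorm_rpow x q
  have hY := aemeasurable_enorm_rpow y q
  have h1 := condLExp_mono (mΩ := m) (P := μ) (X := fun ω => ‖(x + y) ω‖ₑ ^ q)
    (Y := (fun ω => w a ω * ‖x ω‖ₑ ^ q) + fun ω => w b ω * ‖y ω‖ₑ ^ q) (by
      filter_upwards [enorm_L0_add x y] with ω h
      refine (ENNReal.rpow_le_rpow h hq0.le).trans ?_
      change _ ≤ w a ω * ‖x ω‖ₑ ^ q + w b ω * ‖y ω‖ₑ ^ q
      by_cases hab : a ω + b ω = ∞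
      · simp only [w, if_pos hab]
        by_cases hx0 : ‖x ω‖ₑ = 0
        · rw [hx0, zero_add, ENNReal.zero_rpow_of_pos hq0, mul_zero, zero_add]
          exact le_mul_of_one_le_left' le_top
        · rw [ENNReal.top_mul (by
            rw [Ne, ENNReal.rpow_eq_zero_iff]; simp [hx0, hq0.not_gt]), top_add]
          exact le_top
      · simp only [w, if_neg hab]
        obtain ⟨h2, h3⟩ := ENNReal.add_ne_top.1 hab
        exact ENN_add_rpow_le hq (ha0 ω) h2 (hb0 ω) h3 _ _)
  filter_upwards [h1, condLExp_add_left (mΩ := m) (P := μ) (X := fun ω => w a ω * ‖x ω‖ₑ ^ q)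
    (fun ω => w b ω * ‖y ω‖ₑ ^ q) (((hw a ha).mono hm le_rfl).aemeasurable.mul hX),
    condLExp_mul_left hm (hw a ha) hX, condLExp_mul_left hm (hw b hb) hY, hx, hy]
    with ω g1 g2 g3 g4 g5 g6
  refine g1.trans ?_
  rw [g2, Pi.add_apply, g3, g4]
  by_cases hab : a ω + b ω = ∞
  · rw [hab, ENNReal.top_rpow_of_pos hq0]; exact le_top
  · obtain ⟨h2, h3⟩ := ENNReal.add_ne_top.1 hab
    simp only [w, if_neg hab]
    refine le_of_le_of_eq ?_ (ENN_weights_eq hq (ha0 ω) h2 (hb0 ω) h3)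
    gcongr

theorem measurable_eCondNorm (hm : m ≤ m0) (p : ℝ≥0∞) (x : L0 μ ℝ) :
    Measurable[m] (L0rep (eCondNorm hm p x)) := @measurable_L0rep _ m _ _

theorem one_le_toReal_ENN {p : ℝ≥0∞} (hp1 : 1 ≤ p) (hp : p ≠ ∞) : 1 ≤ p.toReal := by
  rw [← ENNReal.toReal_one]; exact ENNReal.toReal_mono hp hp1

theorem eCondNorm_add_le (hm : m ≤ m0) {p : ℝ≥0∞} (hp1 : 1 ≤ p) (x y : L0 μ ℝ) :
    ∀ᵐ ω ∂(μ.trim hm), L0rep (eCondNorm hm p (x + y)) ω ≤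
      L0rep (eCondNorm hm p x) ω + L0rep (eCondNorm hm p y) ω := by
  have hx := measurable_eCondNorm hm p x
  have hy := measurable_eCondNorm hm p y
  by_cases hp : p = ∞
  · subst hp
    refine (eCondNorm_top_le_iff hm _ (measurable_add_ENN hx hy)).2 ?_
    filter_upwards [(eCondNorm_top_le_iff hm x hx).1 (ae_of_all _ fun _ => le_rfl),
      (eCondNorm_top_le_iff hm y hy).1 (ae_of_all _ fun _ => le_rfl), enorm_L0_add x y]
      with ω h1 h2 h3
    exact h3.trans (add_le_add h1 h2)
  have hq := one_le_toReal_ENN hp1 hp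
  -- Adding `1 / k` makes the bounds nonzero, as the weights require; `k = 0` gives `∞`, which is
  -- harmless in the limit.
  have key : ∀ k : ℕ, ∀ᵐ ω ∂(μ.trim hm), L0rep (eCondNorm hm p (x + y)) ω ≤
      (L0rep (eCondNorm hm p x) ω + (k : ℝ≥0∞)⁻¹) +
        (L0rep (eCondNorm hm p y) ω + (k : ℝ≥0∞)⁻¹) := by
    intro k
    have hxk : Measurable[m] fun ω => L0rep (eCondNorm hm p x) ω + (k : ℝ≥0∞)⁻¹ :=
      measurable_add_ENN hx (@measurable_const _ _ _ m _)
    have hyk : Measurable[m] fun ω => L0rep (eCondNorm hm p y) ω + (k : ℝ≥0∞)⁻¹ :=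
      measurable_add_ENN hy (@measurable_const _ _ _ m _)
    refine (eCondNorm_le_iff hm hp1 hp _ (measurable_add_ENN hxk hyk)).2 ?_
    refine condLExp_add_rpow_le hm hq x y hxk hyk (fun ω => by simp) (fun ω => by simp) ?_ ?_
    · exact (eCondNorm_le_iff hm hp1 hp _ hxk).1 (ae_of_all _ fun _ => le_self_add)
    · exact (eCondNorm_le_iff hm hp1 hp _ hyk).1 (ae_of_all _ fun _ => le_self_add)
  filter_upwards [ae_all_iff.2 key] with ω h
  have ht : ∀ c : ℝ≥0∞, Filter.Tendsto (fun k : ℕ => c + (k : ℝ≥0∞)⁻¹) Filter.atTop (nhds (c + 0)) :=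
    fun c => ENNReal.tendsto_inv_nat_nhds_zero.const_add c
  simp only [add_zero] at ht
  exact ge_of_tendsto' ((ht _).add (ht _)) h

theorem eCondNorm_smul_le (hm : m ≤ m0) {p : ℝ≥0∞} (hp1 : 1 ≤ p) (ξ : L0 (μ.trim hm) ℝ)
    (x : L0 μ ℝ) : ∀ᵐ ω ∂(μ.trim hm), L0rep (eCondNorm hm p (ξ • x)) ω ≤
      ‖ξ ω‖ₑ * L0rep (eCondNorm hm p x) ω := by
  have hx := measurable_eCondNorm hm p x
  have hξ := @measurable_L0rep _ m _ (L0enorm ξ)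
  have hmul := measurable_mul_ENN hξ hx
  suffices h : ∀ᵐ ω ∂(μ.trim hm), L0rep (eCondNorm hm p (ξ • x)) ω ≤
      L0rep (L0enorm ξ) ω * L0rep (eCondNorm hm p x) ω by
    filter_upwards [h, L0rep_L0enorm ξ] with ω h1 h2
    rwa [h2] at h1
  by_cases hp : p = ∞
  · subst hp
    refine (eCondNorm_top_le_iff hm _ hmul).2 ?_
    filter_upwards [(eCondNorm_top_le_iff hm x hx).1 (ae_of_all _ fun _ => le_rfl),
      enorm_L0_smul hm ξ x] with ω h1 h2
    rw [h2]; exact mul_le_mul_right h1 _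
  have hq : 0 ≤ p.toReal := zero_le_one.trans (one_le_toReal_ENN hp1 hp)
  refine (eCondNorm_le_iff hm hp1 hp _ hmul).2 ?_
  have h3 := condLExp_congr_ae (mΩ := m) (P := μ) (X := fun ω => ‖(ξ • x) ω‖ₑ ^ p.toReal)
    (Y := fun ω => L0rep (L0enorm ξ) ω ^ p.toReal * ‖x ω‖ₑ ^ p.toReal) (by
      filter_upwards [enorm_L0_smul hm ξ x] with ω h
      rw [h, ENNReal.mul_rpow_of_nonneg _ _ hq])
  filter_upwards [h3, condLExp_mul_left hm (measurable_rpow_ENN hξ p.toReal)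
    (aemeasurable_enorm_rpow x p.toReal), condLExp_eq_eCondNorm_rpow hm hp1 hp x] with ω g1 g2 g3
  rw [g1, g2, g3, ENNReal.mul_rpow_of_nonneg _ _ hq]

theorem eq_zero_of_eCondNorm_le_zero (hm : m ≤ m0) {p : ℝ≥0∞} (hp1 : 1 ≤ p) (x : L0 μ ℝ)
    (h : ∀ᵐ ω ∂(μ.trim hm), L0rep (eCondNorm hm p x) ω ≤ 0) : x = 0 := by
  suffices hx : ∀ᵐ ω ∂μ, ‖x ω‖ₑ = 0 by
    refine L0_ext ?_
    filter_upwards [hx, coe_L0_zero (μ := μ) (R := ℝ)] with ω h1 h2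
    rw [h2]; exact enorm_eq_zero.1 h1
  by_cases hp : p = ∞
  · subst hp
    filter_upwards [(eCondNorm_top_le_iff hm x (@measurable_const _ _ _ m _)).1 h] with ω h1
    exact le_antisymm h1 zero_le
  have hq : 0 < p.toReal := zero_lt_one.trans_le (one_le_toReal_ENN hp1 hp)
  have h1 := (eCondNorm_le_iff hm hp1 hp x (@measurable_const _ _ _ m _)).1 h
  have h2 : ∫⁻ ω, ‖x ω‖ₑ ^ p.toReal ∂μ = 0 := by
    rw [← lintegral_condLExp hm μ]
    refine (lintegral_congr_ae (g := fun _ => 0) ?_).trans lintegral_zero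
    filter_upwards [h1] with ω h
    rw [ENNReal.zero_rpow_of_pos hq] at h
    exact le_antisymm h zero_le
  rw [lintegral_eq_zero_iff' (aemeasurable_enorm_rpow x _)] at h2
  filter_upwards [h2] with ω h
  exact (ENNReal.rpow_eq_zero_iff_of_pos hq).1 h

/-- The conditional norm is local. -/
theorem eCondNorm_le_of_mem (hm : m ≤ m0) {p : ℝ≥0∞} (hp1 : 1 ≤ p) (x : L0 μ ℝ) {A : Set Ω}
    (hA : MeasurableSet[m] A) : ∀ᵐ ω ∂(μ.trim hm), ω ∈ A → L0rep (eCondNorm hm p x) ω ≤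
      L0rep (eCondNorm hm p (L0ind (μ.trim hm) ℝ A hA • x)) ω := by
  have e : L0ind (μ.trim hm) ℝ A hA • x + L0ind (μ.trim hm) ℝ Aᶜ hA.compl • x = x := by
    rw [← add_smul]
    have : L0ind (μ.trim hm) ℝ A hA + L0ind (μ.trim hm) ℝ Aᶜ hA.compl = 1 := by
      refine L0_ext ?_
      filter_upwards [coe_L0ind (μ := μ.trim hm) ℝ hA, coe_L0ind (μ := μ.trim hm) ℝ hA.compl,
        coe_L0_one (μ := μ.trim hm) (R := ℝ), coe_L0_add (L0ind (μ.trim hm) ℝ A hA)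
        (L0ind (μ.trim hm) ℝ Aᶜ hA.compl)] with ω h1 h2 h3 h4
      rw [h4, h1, h2, h3]
      by_cases hω : ω ∈ A <;> simp [hω]
    rw [this, one_smul]
  have h1 := eCondNorm_add_le hm hp1 (L0ind (μ.trim hm) ℝ A hA • x)
    (L0ind (μ.trim hm) ℝ Aᶜ hA.compl • x)
  rw [e] at h1
  filter_upwards [h1, eCondNorm_smul_le hm hp1 (L0ind (μ.trim hm) ℝ Aᶜ hA.compl) x,
    coe_L0ind (μ := μ.trim hm) ℝ hA.compl] with ω g1 g2 g3 hω
  rw [g3, Set.indicator_of_notMem (by simpa using hω), enorm_zero, zero_mul] at g2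
  rwa [le_antisymm g2 zero_le, add_zero] at g1

/-- For the lower bound, let `η = ξ⁻¹` with `0⁻¹ = 0`, so that `η ξ` is the indicator of `{ξ ≠ 0}`.
The upper bound for `η • (ξ • x)`, with locality on that event, bounds the norm of `x` there. -/
theorem eCondNorm_smul (hm : m ≤ m0) {p : ℝ≥0∞} (hp1 : 1 ≤ p) (ξ : L0 (μ.trim hm) ℝ)
    (x : L0 μ ℝ) : ∀ᵐ ω ∂(μ.trim hm), L0rep (eCondNorm hm p (ξ • x)) ω =
      ‖ξ ω‖ₑ * L0rep (eCondNorm hm p x) ω := by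
  have hA : MeasurableSet[m] {ω | ξ ω ≠ 0} := measurableSet_L0_ne_zero ξ
  obtain ⟨η, hη⟩ := exists_L0_eq (μ := μ.trim hm) (measurable_L0_inv ξ)
  have e : η * ξ = L0ind (μ.trim hm) ℝ _ hA := by
    refine L0_ext ?_
    filter_upwards [coe_L0_mul η ξ, hη, coe_L0ind (μ := μ.trim hm) ℝ hA] with ω h1 h2 h3
    rw [h1, h2, h3]
    by_cases hω : ξ ω = 0
    · simp [hω]
    · rw [inv_mul_cancel₀ hω, Set.indicator_of_mem (show ω ∈ {ω | ξ ω ≠ 0} from hω)]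
  have h2 := eCondNorm_smul_le hm hp1 η (ξ • x)
  rw [smul_smul, e] at h2
  filter_upwards [eCondNorm_smul_le hm hp1 ξ x, h2, eCondNorm_le_of_mem hm hp1 x hA, hη]
    with ω g1 g2 g3 g4
  refine le_antisymm g1 ?_
  by_cases hω : ξ ω = 0
  · rw [hω, enorm_zero, zero_mul]; exact zero_le
  · have h0 : ‖ξ ω‖ₑ ≠ 0 := enorm_ne_zero.2 hω
    calc ‖ξ ω‖ₑ * L0rep (eCondNorm hm p x) ω
        ≤ ‖ξ ω‖ₑ * (‖η ω‖ₑ * L0rep (eCondNorm hm p (ξ • x)) ω) :=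
          mul_le_mul_right ((g3 hω).trans g2) _
      _ = L0rep (eCondNorm hm p (ξ • x)) ω := by
        rw [← mul_assoc, ← enorm_mul, g4, mul_inv_cancel₀ hω, enorm_one, one_mul]

end CondNorm

theorem coe_L0toReal {Ω : Type*} {m : MeasurableSpace Ω} {μ : Measure Ω}
    (ξ : Ω →ₘ[μ] ENNReal) : ∀ᵐ ω ∂μ, L0toReal ξ ω = (L0rep ξ ω).toReal :=
  AEEqFun.coeFn_compMeasurable _ _ _

/-! ### Norm, concatenation and geometric completeness of `L^p_F(E)`. -/

section LpFComplete

open scoped ENNReal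

variable {Ω : Type*} {m m0 : MeasurableSpace Ω} {μ : Measure[m0] Ω}

/-- Conditional Fatou lemma, for a constant bound. -/
theorem eCondNorm_le_of_tendsto [IsFiniteMeasure μ] (hm : m ≤ m0) {p : ℝ≥0∞} (hp1 : 1 ≤ p)
    (z : ℕ → L0 μ ℝ) (w : L0 μ ℝ) (c : ℝ≥0∞)
    (hz : ∀ᵐ ω ∂μ, Filter.Tendsto (fun k => z k ω) Filter.atTop (nhds (w ω)))
    (hc : ∀ k, ∀ᵐ ω ∂(μ.trim hm), L0rep (eCondNorm hm p (z k)) ω ≤ c) :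
    ∀ᵐ ω ∂(μ.trim hm), L0rep (eCondNorm hm p w) ω ≤ c := by
  have hcm : Measurable[m] fun _ : Ω => c := @measurable_const _ _ _ m _
  by_cases hp : p = ∞
  · subst hp
    rw [eCondNorm_top_le_iff hm _ hcm]
    filter_upwards [hz, ae_all_iff.2 fun k => (eCondNorm_top_le_iff hm (z k) hcm).1 (hc k)]
      with ω h1 h2
    exact le_of_tendsto' h1.enorm h2
  rw [eCondNorm_le_iff hm hp1 hp _ hcm]
  have hq : 0 ≤ p.toReal := zero_le_one.trans (one_le_toReal_ENN hp1 hp)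
  -- The conditional expectation is compared with `c ^ p` through integrals over events of the
  -- sub-σ-algebra, where the ordinary Fatou lemma applies.
  refine ae_of_ae_trim hm (ae_le_of_forall_setLIntegral_le_of_sigmaFinite (μ := μ.trim hm)
    (measurable_condLExp m μ _) fun s hs _ => ?_)
  rw [setLIntegral_condLExp_trim hm μ _ hs, lintegral_const,
    Measure.restrict_apply_univ, trim_measurableSet_eq hm hs]
  have hbound : ∀ k, ∫⁻ ω in s, ‖z k ω‖ₑ ^ p.toReal ∂μ ≤ c ^ p.toReal * μ s := by
    intro k
    rw [← setLIntegral_condLExp hm μ _ hs, ← setLIntegral_const]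
    exact lintegral_mono_ae (ae_restrict_of_ae ((eCondNorm_le_iff hm hp1 hp _ hcm).1 (hc k)))
  calc ∫⁻ ω in s, ‖w ω‖ₑ ^ p.toReal ∂μ
      = ∫⁻ ω in s, Filter.liminf (fun k => ‖z k ω‖ₑ ^ p.toReal) Filter.atTop ∂μ := by
        refine lintegral_congr_ae (ae_restrict_of_ae ?_)
        filter_upwards [hz] with ω h
        exact ((ENNReal.continuous_rpow_const.tendsto _).comp h.enorm).liminf_eq.symm
    _ ≤ Filter.liminf (fun k => ∫⁻ ω in s, ‖z k ω‖ₑ ^ p.toReal ∂μ) Filter.atTop :=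
        lintegral_liminf_le' fun k => (aemeasurable_enorm_rpow (z k) _).restrict
    _ ≤ c ^ p.toReal * μ s := Filter.liminf_le_of_le (by isBoundedDefault) fun b hb => by
        obtain ⟨k, hk⟩ := hb.exists
        exact hk.trans (hbound k)

/-- Constant conditional bounds integrate to the same unconditional bound because `μ` has mass one.
This links geometric sequences to the classical `L^p` theory. -/
theorem eLpNorm_le_of_eCondNorm_le [IsProbabilityMeasure μ] (hm : m ≤ m0) {p : ℝ≥0∞}
    (hp1 : 1 ≤ p) (x : L0 μ ℝ) (c : ℝ≥0∞)
    (hc : ∀ᵐ ω ∂(μ.trim hm), L0rep (eCondNorm hm p x) ω ≤ c) : eLpNorm x p μ ≤ c := by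
  have hcm : Measurable[m] fun _ : Ω => c := @measurable_const _ _ _ m _
  by_cases hp : p = ∞
  · subst hp
    rw [eLpNorm_exponent_top]
    exact essSup_le_of_ae_le _ ((eCondNorm_top_le_iff hm _ hcm).1 hc)
  have hp0 : p ≠ 0 := (zero_lt_one.trans_le hp1).ne'
  rw [eLpNorm_eq_lintegral_rpow_enorm_toReal hp0 hp, one_div,
    ENNReal.rpow_inv_le_iff (ENNReal.toReal_pos hp0 hp), ← lintegral_condLExp hm μ]
  refine (lintegral_mono_ae ((eCondNorm_le_iff hm hp1 hp _ hcm).1 hc)).trans_eq ?_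
  rw [lintegral_const, measure_univ, mul_one]

theorem coe_LpFnorm [IsFiniteMeasure μ] (hm : m ≤ m0) (p : ℝ≥0∞) (x : LpF (μ := μ) hm p) :
    ∀ᵐ ω ∂(μ.trim hm), LpFnorm hm p x ω = (L0rep (eCondNorm hm p (x : L0 μ ℝ)) ω).toReal :=
  coe_L0toReal _

theorem ofReal_LpFnorm [IsFiniteMeasure μ] (hm : m ≤ m0) (p : ℝ≥0∞) (x : LpF (μ := μ) hm p) :
    ∀ᵐ ω ∂(μ.trim hm),
      L0rep (eCondNorm hm p (x : L0 μ ℝ)) ω = ENNReal.ofReal (LpFnorm hm p x ω) := by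
  have hx : CondNormFinite hm p (x : L0 μ ℝ) := x.2
  filter_upwards [coe_LpFnorm hm p x, hx] with ω h1 h2
  rw [h1, ENNReal.ofReal_toReal h2.ne]

theorem LpFnorm_nonneg [IsFiniteMeasure μ] (hm : m ≤ m0) (p : ℝ≥0∞) (x : LpF (μ := μ) hm p) :
    ∀ᵐ ω ∂(μ.trim hm), 0 ≤ LpFnorm hm p x ω := by
  filter_upwards [coe_LpFnorm hm p x] with ω h
  rw [h]; exact ENNReal.toReal_nonneg

theorem isL0Norm_LpFnorm [IsFiniteMeasure μ] (hm : m ≤ m0) {p : ℝ≥0∞} (hp1 : 1 ≤ p) :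
    IsL0Norm ℝ (LpFnorm (μ := μ) hm p) where
  nonneg x := by
    rw [L0_le_iff]
    filter_upwards [LpFnorm_nonneg hm p x, coe_L0_zero (μ := μ.trim hm) (R := ℝ)] with ω h1 h2
    rwa [h2]
  eq_zero x hx := by
    refine Subtype.ext (eq_zero_of_eCondNorm_le_zero hm hp1 _ ?_)
    filter_upwards [ofReal_LpFnorm hm p x, coe_L0_zero (μ := μ.trim hm) (R := ℝ)] with ω h1 h2
    rw [h1, hx, h2, ENNReal.ofReal_zero]
  add_le x y := by
    rw [L0_le_iff]
    filter_upwards [ofReal_LpFnorm hm p x, ofReal_LpFnorm hm p y, ofReal_LpFnorm hm p (x + y),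
      LpFnorm_nonneg hm p x, LpFnorm_nonneg hm p y, coe_L0_add (LpFnorm hm p x) (LpFnorm hm p y),
      eCondNorm_add_le hm hp1 (x : L0 μ ℝ) y] with ω h1 h2 h3 h4 h5 h6 h7
    rw [← Submodule.coe_add, h1, h2, h3, ← ENNReal.ofReal_add h4 h5,
      ENNReal.ofReal_le_ofReal_iff (add_nonneg h4 h5)] at h7
    rwa [h6]
  smul ξ x := by
    refine L0_ext ?_
    filter_upwards [coe_LpFnorm hm p x, coe_LpFnorm hm p (ξ • x), coe_L0abs ξ,
      coe_L0_mul (L0abs ξ) (LpFnorm hm p x), eCondNorm_smul hm hp1 ξ (x : L0 μ ℝ)]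
      with ω h1 h2 h3 h4 h5
    rw [h4, h1, h2, h3, Submodule.coe_smul, h5, ENNReal.toReal_mul, toReal_enorm]

theorem LpFnorm_le_iff [IsFiniteMeasure μ] (hm : m ≤ m0) {p : ℝ≥0∞} (x : LpF (μ := μ) hm p)
    {c : ℝ} (hc : 0 ≤ c) : (∀ᵐ ω ∂(μ.trim hm), LpFnorm hm p x ω ≤ c) ↔
      ∀ᵐ ω ∂(μ.trim hm), L0rep (eCondNorm hm p (x : L0 μ ℝ)) ω ≤ ENNReal.ofReal c := by
  constructor <;> intro h <;> filter_upwards [h, ofReal_LpFnorm hm p x] with ω h1 h2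
  · rw [h2]; exact ENNReal.ofReal_le_ofReal h1
  · rwa [h2, ENNReal.ofReal_le_ofReal_iff hc] at h1

/-- Representatives are glued pointwise. No uniform bound is needed, since finiteness of the
conditional norm can be checked on each `A n` by locality. -/
theorem hasCountableConcat_LpF [IsFiniteMeasure μ] (hm : m ≤ m0) {p : ℝ≥0∞} (hp1 : 1 ≤ p) :
    HasCountableConcat (μ.trim hm) ℝ (Set.univ : Set (LpF (μ := μ) hm p)) := by
  intro A hA hd hU x _
  obtain ⟨f, hf, hfe⟩ := exists_measurable_piecewise A (fun n => hm _ (hA n))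
    (fun n => ((x n : L0 μ ℝ) : Ω → ℝ)) (fun n => AEEqFun.measurable (x n : L0 μ ℝ))
    (fun i j hij ω h => absurd h.2 (Set.disjoint_left.1 (hd hij) h.1))
  obtain ⟨y, hy⟩ := exists_L0_eq (μ := μ) hf
  have hloc : ∀ n, L0ind (μ.trim hm) ℝ (A n) (hA n) • y =
      L0ind (μ.trim hm) ℝ (A n) (hA n) • (x n : L0 μ ℝ) := by
    intro n
    refine L0_ext ?_
    filter_upwards [AEEqFun.coeFn_mul (L0incl hm (L0ind (μ.trim hm) ℝ (A n) (hA n))) y,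
      AEEqFun.coeFn_mul (L0incl hm (L0ind (μ.trim hm) ℝ (A n) (hA n))) (x n : L0 μ ℝ),
      coe_L0comp id (measurePreserving_id_trim hm) (L0ind (μ.trim hm) ℝ (A n) (hA n)),
      ae_of_ae_trim hm (coe_L0ind (μ := μ.trim hm) ℝ (hA n)), hy] with ω h1 h2 h3 h4 h5
    change (L0incl hm (L0ind (μ.trim hm) ℝ (A n) (hA n)) * y) ω =
      (L0incl hm (L0ind (μ.trim hm) ℝ (A n) (hA n)) * (x n : L0 μ ℝ)) ω
    have h6 : L0incl hm (L0ind (μ.trim hm) ℝ (A n) (hA n)) ω =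
        (A n).indicator (fun _ => (1 : ℝ)) ω := h3.trans h4
    rw [h1, h2, Pi.mul_apply, Pi.mul_apply, h6]
    by_cases hω : ω ∈ A n
    · rw [h5, hfe n hω]
    · rw [Set.indicator_of_notMem hω, zero_mul, zero_mul]
  have hfin : CondNormFinite hm p y := by
    have h1 : ∀ n, ∀ᵐ ω ∂(μ.trim hm), ω ∈ A n → L0rep (eCondNorm hm p y) ω < ∞ := by
      intro n
      have h2 : CondNormFinite hm p (L0ind (μ.trim hm) ℝ (A n) (hA n) • (x n : L0 μ ℝ)) :=
        condNormFinite_smul hm p _ (x n).2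
      filter_upwards [eCondNorm_le_of_mem hm hp1 y (hA n), h2] with ω g1 g2 hω
      rw [hloc n] at g1
      exact (g1 hω).trans_lt g2
    unfold CondNormFinite
    filter_upwards [ae_all_iff.2 h1] with ω h
    obtain ⟨n, hn⟩ := Set.mem_iUnion.1 (hU ▸ Set.mem_univ ω : ω ∈ ⋃ n, A n)
    exact h n hn
  exact ⟨⟨y, hfin⟩, trivial, fun n => Subtype.ext (hloc n)⟩

/-- The terms need not lie in `L^p`, but their differences do, with summable constant bounds. So the
sequence converges almost everywhere, and the conditional Fatou lemma passes the bounds to the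
limit. -/
theorem geometricallyComplete_LpFnorm [IsProbabilityMeasure μ] (hm : m ≤ m0) {p : ℝ≥0∞}
    (hp1 : 1 ≤ p) : GeometricallyComplete (LpFnorm (μ := μ) hm p) := by
  intro x hx
  have hN := isL0Norm_LpFnorm (μ := μ) hm hp1
  have hinc : ∀ k n, k ≤ n → ∀ᵐ ω ∂(μ.trim hm),
      L0rep (eCondNorm hm p ((x n : L0 μ ℝ) - (x k : L0 μ ℝ))) ω ≤ ENNReal.ofReal (2 * (1 / 2 : ℝ) ^ k) := by
    intro k n hkn
    rw [← Submodule.coe_sub, ← LpFnorm_le_iff hm _ (by positivity)]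
    filter_upwards [hN.coe_sub_le_of_geometric hx hkn] with ω h
    have : (0 : ℝ) < (1 / 2 : ℝ) ^ n := by positivity
    linarith
  have hinc' : ∀ N i j, N ≤ i → N ≤ j → ∀ᵐ ω ∂(μ.trim hm),
      L0rep (eCondNorm hm p ((x i : L0 μ ℝ) - (x j : L0 μ ℝ))) ω ≤ ENNReal.ofReal (4 * (1 / 2 : ℝ) ^ N) := by
    intro N i j hi hj
    rw [← Submodule.coe_sub, ← LpFnorm_le_iff hm _ (by positivity)]
    filter_upwards [hN.coe_sub_le_of_geometric hx hi, hN.coe_sub_le_of_geometric hx hj,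
      hN.coe_sub_le (x i) (x N) (x j), hN.coe_sub_comm (x N) (x j)] with ω h1 h2 h3 h4
    have : (0 : ℝ) < (1 / 2 : ℝ) ^ i := by positivity
    have : (0 : ℝ) < (1 / 2 : ℝ) ^ j := by positivity
    linarith
  -- `8` instead of the `4` of `hinc'`, because the convergence criterion asks for strict
  -- inequalities.
  have hsum : ∑' N : ℕ, ENNReal.ofReal (8 * (1 / 2 : ℝ) ^ N) ≠ ∞ :=
    (summable_geometric_two.mul_left 8).tsum_ofReal_ne_top
  have hconv := Lp.ae_tendsto_of_cauchy_eLpNorm (μ := μ) (f := fun n => ((x n : L0 μ ℝ) : Ω → ℝ))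
    (fun n => AEEqFun.aestronglyMeasurable _) hp1 hsum (by
      intro N i j hi hj
      rw [← eLpNorm_congr_ae (AEEqFun.coeFn_sub (x i : L0 μ ℝ) (x j : L0 μ ℝ))]
      refine (eLpNorm_le_of_eCondNorm_le hm hp1 _ _ (hinc' N i j hi hj)).trans_lt ?_
      rw [ENNReal.ofReal_lt_ofReal_iff (by positivity)]
      have : (0 : ℝ) < (1 / 2 : ℝ) ^ N := by positivity
      linarith)
  obtain ⟨f, hf, hfl⟩ := exists_stronglyMeasurable_limit_of_tendsto_ae
    (fun n => AEEqFun.aestronglyMeasurable (x n : L0 μ ℝ)) hconv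
  obtain ⟨y, hy⟩ := exists_L0_eq (μ := μ) hf.measurable
  have hlim : ∀ n, ∀ᵐ ω ∂(μ.trim hm),
      L0rep (eCondNorm hm p (y - (x n : L0 μ ℝ))) ω ≤ ENNReal.ofReal (2 * (1 / 2 : ℝ) ^ n) := by
    intro n
    refine eCondNorm_le_of_tendsto hm hp1 (fun k => (x (k + n) : L0 μ ℝ) - (x n : L0 μ ℝ)) _ _ ?_
      fun k => hinc n (k + n) (Nat.le_add_left n k)
    filter_upwards [hfl, hy, coe_L0_sub y (x n : L0 μ ℝ),
      ae_all_iff.2 fun k => coe_L0_sub (x (k + n) : L0 μ ℝ) (x n : L0 μ ℝ)] with ω h1 h2 h3 h4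
    simp only [h4, h3, h2]
    exact ((Filter.tendsto_add_atTop_iff_nat n).2 h1).sub_const _
  have hfin : CondNormFinite hm p y := by
    have h0 : CondNormFinite hm p (y - (x 0 : L0 μ ℝ)) := by
      unfold CondNormFinite
      filter_upwards [hlim 0] with ω h
      exact h.trans_lt ENNReal.ofReal_lt_top
    have := condNormFinite_add hm p h0 (x 0).2
    rwa [sub_add_cancel] at this
  refine ⟨⟨y, hfin⟩, fun n => ?_⟩
  rw [LpFnorm_le_iff hm _ (by positivity)]
  exact hlim n

end LpFComplete

end RandomModule

theorem corollary3p42 {Ω : Type*} {m0 : MeasurableSpace Ω} (μ : Measure Ω)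
    [IsProbabilityMeasure μ] :
    (∀ (K : Type*) [RCLike K] (E : Type*) [AddCommGroup E] [Module (RandomModule.L0 μ K) E]
        (N : E → RandomModule.L0 μ ℝ),
      RandomModule.IsL0Norm K N → RandomModule.IsTopComplete (RandomModule.Tc N) →
      RandomModule.HasCountableConcat μ K (Set.univ : Set E) →
      RandomModule.IsL0PreBarreled μ K (RandomModule.Tc N)) ∧
    (∀ (m : MeasurableSpace Ω) (hm : m ≤ m0) (p : ENNReal), 1 ≤ p →
      RandomModule.IsL0Norm ℝ (RandomModule.LpFnorm (μ := μ) hm p) ∧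
      RandomModule.IsL0PreBarreled (μ.trim hm) ℝ
        (RandomModule.Tc (RandomModule.LpFnorm (μ := μ) hm p))) := by

  refine ⟨fun K _ E _ _ N hN hc hcc => ?_, fun m hm p hp => ?_⟩
  · exact (hN.geometricallyComplete hc hcc).isL0PreBarreled hN hcc
  · have hN := RandomModule.isL0Norm_LpFnorm (μ := μ) hm hp
    exact ⟨hN, (RandomModule.geometricallyComplete_LpFnorm hm hp).isL0PreBarreled hN
      (RandomModule.hasCountableConcat_LpF hm hp)⟩
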